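/- Let $R=\bigoplus_{n\in\mathbb Z}R_n$ be a commutative Noetherian $\mathbb Z$-graded ring which is $H$-local, i.e. $R$ has exactly one ideal $P$ that is maximal among the proper graded ideals of $R$ (the $H$-maximal ideal, which is prime but need not be a maximal ideal), and let $M\neq(0)$ be a finitely generated graded $R$-module. For a Noetherian ring $A$ and a finitely generated $A$-module $N \ne (0)$ put $\mathcal S(N)=\{\dim_A L\mid (0)\ne L\subseteq N \text{ an } A\text{-submodule}\}=\{d_1<d_2<\dots<d_\ell\}$. The dimension filtration of $N$ is the chain $(0)=D_0\subsetneq D_1\subsetneq\dots\subsetneq D_\ell=N$, where, for $1\le i\le \ell$, $D_i$ is the largest $A$-submodule of $N$ with $\dim_A D_i\le d_i$. The module $N$ is called sequentially Cohen-Macaulay if $D_i/D_{i-1}$ is a Cohen-Macaulay $A$-module for every $1\le i\le\ell$; here a finitely generated $A$-module $C$ is Cohen-Macaulay if $\operatorname{depth}_{A_{\mathfrak m}}C_{\mathfrak m}=\dim_{A_{\mathfrak m}}C_{\mathfrak m}$ for every maximal ideal $\mathfrak m\in\operatorname{Supp}_A C$. Then the following conditions are equivalent: (1) $M$ is a sequentially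 Cohen-Macaulay $R$-module; (2) $M_P$ is a sequentially Cohen-Macaulay $R_P$-module. When this is the case, $M_{\mathfrak p}$ is a sequentially Cohen-Macaulay $R_{\mathfrak p}$-module for every $\mathfrak p\in\operatorname{Supp}_R M$. -/

import Mathlib

noncomputable section

/-! ### H-local rings -/

section HLocal

variable {R : Type*} [CommRing R] (𝒜 : ℤ → AddSubgroup R) [GradedRing 𝒜]

/-- An H-maximal ideal of a `ℤ`-graded ring: a proper graded ideal which is maximal among the
proper graded ideals (it need not be a maximal ideal). -/
def IsHMaximal (P : Ideal R) : Prop :=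
  P.IsHomogeneous 𝒜 ∧ P ≠ ⊤ ∧ ∀ J : Ideal R, J.IsHomogeneous 𝒜 → P < J → J = ⊤

/-- A `ℤ`-graded ring is H-local if it has exactly one H-maximal ideal. -/
class IsHLocalRing : Prop where
  existsUnique_isHMaximal : ∃! P : Ideal R, IsHMaximal 𝒜 P

/-- The unique H-maximal ideal of an H-local ring. -/
def hMaximalIdeal [IsHLocalRing 𝒜] : Ideal R :=
  (IsHLocalRing.existsUnique_isHMaximal (𝒜 := 𝒜)).choose

theorem hMaximalIdeal_isHMaximal [IsHLocalRing 𝒜] : IsHMaximal 𝒜 (hMaximalIdeal 𝒜) :=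
  (IsHLocalRing.existsUnique_isHMaximal (𝒜 := 𝒜)).choose_spec.1

variable {𝒜} in
theorem IsHMaximal.isPrime {P : Ideal R} (hP : IsHMaximal 𝒜 P) : P.IsPrime := by
  obtain ⟨hh, hne, hmax⟩ := hP
  refine hh.isPrime_of_homogeneous_mem_or_mem hne fun {x y} hx _ hxy => ?_
  by_contra! hcon
  obtain ⟨hxP, hyP⟩ := hcon
  have hsp : (Ideal.span {x}).IsHomogeneous 𝒜 :=
    Ideal.homogeneous_span 𝒜 {x} (by rintro z rfl; exact hx)
  have htop : P ⊔ Ideal.span {x} = ⊤ := by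
    refine hmax _ (hh.sup hsp) (lt_of_le_of_ne le_sup_left fun h => hxP ?_)
    rw [h]
    exact Ideal.mem_sup_right (Ideal.mem_span_singleton_self x)
  have h1 : (1 : R) ∈ P ⊔ Ideal.span {x} := htop ▸ Submodule.mem_top
  obtain ⟨p, hp, z, hz, hpz⟩ := Submodule.mem_sup.mp h1
  obtain ⟨a, rfl⟩ := Ideal.mem_span_singleton.mp hz
  refine hyP ?_
  have hy : y = y * p + a * (x * y) := by linear_combination (-y) * hpz
  rw [hy]
  exact P.add_mem (P.mul_mem_left _ hp) (P.mul_mem_left _ hxy)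

instance hMaximalIdeal_isPrime [IsHLocalRing 𝒜] : (hMaximalIdeal 𝒜).IsPrime :=
  (hMaximalIdeal_isHMaximal 𝒜).isPrime

end HLocal

/-! ### Cohen-Macaulay modules -/

section CohenMacaulay

/-- The depth of a module over a local ring: the supremum of the lengths of the `M`-regular
sequences contained in the maximal ideal. -/
def localDepth (R : Type*) [CommRing R] [IsLocalRing R]
    (M : Type*) [AddCommGroup M] [Module R M] : ℕ∞ :=
  ⨆ rs : {rs : List R // (∀ r ∈ rs, r ∈ IsLocalRing.maximalIdeal R) ∧
    RingTheory.Sequence.IsRegular M rs}, (rs.1.length : ℕ∞)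

/-- A finitely generated module `M` over a Noetherian ring `R` is Cohen-Macaulay if
`depth M_𝔪 = dim M_𝔪` over `R_𝔪` for every maximal ideal `𝔪` in the support of `M`. -/
def IsCohenMacaulayModule (R : Type*) [CommRing R]
    (M : Type*) [AddCommGroup M] [Module R M] : Prop :=
  ∀ m ∈ Module.support R M, m.asIdeal.IsMaximal →
    (localDepth (Localization.AtPrime m.asIdeal)
        (LocalizedModule m.asIdeal.primeCompl M) : WithBot ℕ∞) =
      Module.supportDim (Localization.AtPrime m.asIdeal)
        (LocalizedModule m.asIdeal.primeCompl M)

end CohenMacaulay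

/-! ### The dimension filtration and sequentially Cohen-Macaulay modules -/

section DimensionFiltration

variable (R : Type*) [CommRing R] (M : Type*) [AddCommGroup M] [Module R M]

/-- The set `𝒮(M)` of the dimensions of the nonzero submodules of `M`. -/
def submoduleDims : Set (WithBot ℕ∞) :=
  {d | ∃ N : Submodule R M, N ≠ ⊥ ∧ Module.supportDim R N = d}

variable {R M} in
/-- `D_0, …, D_ℓ` is the dimension filtration of `M`: writing
`𝒮(M) = {d_1 < ⋯ < d_ℓ}`, one has `D_0 = 0` and, for `1 ≤ i ≤ ℓ`, `D_i` is the largest submodule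
of `M` of dimension at most `d_i`. (The index of `d` is shifted by one: `d i` is `d_{i+1}`.) -/
def IsDimensionFiltration {l : ℕ} (D : Fin (l + 1) → Submodule R M) : Prop :=
  ∃ d : Fin l → WithBot ℕ∞, StrictMono d ∧ Set.range d = submoduleDims R M ∧
    D 0 = ⊥ ∧
    ∀ i : Fin l, IsGreatest {N : Submodule R M | Module.supportDim R N ≤ d i} (D i.succ)

/-- `M` is sequentially Cohen-Macaulay: all the quotients `D_i / D_{i-1}`, `1 ≤ i ≤ ℓ`, of its
dimension filtration (which is unique) are Cohen-Macaulay. -/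
def IsSequentiallyCM : Prop :=
  ∃ (l : ℕ) (D : Fin (l + 1) → Submodule R M), IsDimensionFiltration D ∧
    ∀ i : Fin l, IsCohenMacaulayModule R
      (↥(D i.succ) ⧸ (D i.castSucc).submoduleOf (D i.succ))

end DimensionFiltration

end

/-!
Associated primes of a finitely generated graded module are graded. For a prime `q`, let `q*` be
the ideal generated by its homogeneous elements. It is a graded prime, there is no prime strictly
between `q*` and `q`, and if `q ≠ q*`, then `ht (q/p) = ht (q*/p) + 1` for all graded primes
`p ≤ q*`, and a graded module which is Cohen-Macaulay at `q*` is Cohen-Macaulay at `q`.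

Consequently `dim R/p = ht (P/p) + δ` for every graded prime `p`, where `δ = dim R/P`. Hence the
dimension filtration of `M` localizes at `P` to that of `M_P` up to a shift of the dimensions by
`δ`, and a graded subquotient is Cohen-Macaulay as soon as it is so at `P`. Once the subquotients
are Cohen-Macaulay, the difference between `dim R/p` and `ht (q/p)` takes a single value for all
their associated primes `p ≤ q`, so the filtration also localizes well at `q`.
-/

universe u v

open Pointwise

/-! ### Relative heights -/

section RelHeight

variable {α : Type*} [Preorder α]

/-- The supremum of the lengths of the chains contained in the interval `[p, q]`. For `p ≤ q` in a
prime spectrum this is the height of the prime `q / p` of `R / p`; it is `0` if `[p, q]` is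
empty. -/
noncomputable def relHeight (p q : α) : ℕ∞ :=
  ⨆ s : {s : LTSeries α // p ≤ s.head ∧ s.last ≤ q}, (s.1.length : ℕ∞)

theorem length_le_relHeight {p q : α} {s : LTSeries α} (hp : p ≤ s.head) (hq : s.last ≤ q) :
    (s.length : ℕ∞) ≤ relHeight p q :=
  le_iSup (fun s : {s : LTSeries α // p ≤ s.head ∧ s.last ≤ q} => (s.1.length : ℕ∞)) ⟨s, hp, hq⟩

theorem relHeight_le {p q : α} {n : ℕ∞}
    (h : ∀ s : LTSeries α, p ≤ s.head → s.last ≤ q → (s.length : ℕ∞) ≤ n) : relHeight p q ≤ n :=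
  iSup_le fun s => h s.1 s.2.1 s.2.2

theorem coheight_Iic_eq_relHeight (q : α) (p : Set.Iic q) :
    Order.coheight p = relHeight p.1 q := by
  apply le_antisymm
  · refine Order.coheight_le_iff.mpr fun s hs => ?_
    exact length_le_relHeight (s := s.map (fun x => x.1) fun _ _ h => h) hs s.last.2
  · refine relHeight_le fun s hp hq => ?_
    let t : LTSeries (Set.Iic q) :=
      { length := s.length
        toFun := fun i => ⟨s i, (LTSeries.monotone s (Fin.le_last i)).trans hq⟩
        step := fun i => s.step i }
    exact Order.length_le_coheight (p := t) hp

theorem relHeight_mono {p p' q q' : α} (hp : p' ≤ p) (hq : q ≤ q') :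
    relHeight p q ≤ relHeight p' q' :=
  relHeight_le fun _ h₁ h₂ => length_le_relHeight (hp.trans h₁) (h₂.trans hq)

theorem relHeight_le_coheight (p q : α) : relHeight p q ≤ Order.coheight p :=
  relHeight_le fun _ h₁ _ => Order.length_le_coheight h₁

theorem relHeight_le_height (p q : α) : relHeight p q ≤ Order.height q :=
  relHeight_le fun _ _ h₂ => Order.length_le_height h₂

theorem coheight_eq_iSup_relHeight (p : α) :
    Order.coheight p = ⨆ q : Set.Ici p, relHeight p q.1 := by
  refine le_antisymm (Order.coheight_le_iff.mpr fun s hs => ?_)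
    (iSup_le fun q => relHeight_le_coheight p q)
  exact (length_le_relHeight hs le_rfl).trans
    (le_iSup (fun q : Set.Ici p => relHeight p q) ⟨s.last, hs.trans (LTSeries.head_le_last s)⟩)

theorem relHeight_self (p : α) : relHeight p p = 0 := by
  rw [← coheight_Iic_eq_relHeight p ⟨p, le_rfl⟩, Order.coheight_eq_zero]
  exact fun x _ => x.2

theorem relHeight_add_one_le_of_lt_left {p p' q : α} (h : p < p') (hq : p' ≤ q) :
    relHeight p' q + 1 ≤ relHeight p q := by
  rw [← coheight_Iic_eq_relHeight q ⟨p', hq⟩, ← coheight_Iic_eq_relHeight q ⟨p, h.le.trans hq⟩]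
  exact Order.coheight_add_one_le (show (⟨p, _⟩ : Set.Iic q) < ⟨p', hq⟩ from h)

end RelHeight

section RelHeightPartialOrder

variable {α : Type*} [PartialOrder α]

theorem length_add_length_le_relHeight {s t : LTSeries α} (h : s.last ≤ t.head) :
    (s.length + t.length : ℕ∞) ≤ relHeight s.head t.last := by
  rcases h.lt_or_eq with hlt | heq
  · have := length_le_relHeight (p := s.head) (q := t.last) (s := s.append t hlt)
      (by simp) (by simp)
    exact le_trans (by simp [RelSeries.append_length]) this
  · have := length_le_relHeight (p := s.head) (q := t.last) (s := s.smash t heq)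
      (by simp) (by simp)
    simpa using this

theorem relHeight_add_le {p q r : α} (hpq : p ≤ q) (hqr : q ≤ r) :
    relHeight p q + relHeight q r ≤ relHeight p r := by
  have : Nonempty {s : LTSeries α // p ≤ s.head ∧ s.last ≤ q} :=
    ⟨⟨RelSeries.singleton _ p, le_rfl, hpq⟩⟩
  have : Nonempty {s : LTSeries α // q ≤ s.head ∧ s.last ≤ r} :=
    ⟨⟨RelSeries.singleton _ q, le_rfl, hqr⟩⟩
  refine ENat.iSup_add_iSup_le fun s t => ?_
  exact (length_add_length_le_relHeight (s.2.2.trans t.2.1)).trans (relHeight_mono s.2.1 t.2.2)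

theorem relHeight_add_one_le_of_lt_right {p q r : α} (hpq : p ≤ q) (hqr : q < r) :
    relHeight p q + 1 ≤ relHeight p r := by
  refine le_trans ?_ (relHeight_add_le hpq hqr.le)
  gcongr
  simpa [relHeight_self] using relHeight_add_one_le_of_lt_left hqr le_rfl

theorem relHeight_add_coheight_le {p q : α} (hpq : p ≤ q) :
    relHeight p q + Order.coheight q ≤ Order.coheight p := by
  rw [coheight_eq_iSup_relHeight q, ENat.add_iSup]
  exact iSup_le fun r => (relHeight_add_le hpq r.2).trans (relHeight_le_coheight p r)

end RelHeightPartialOrder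

theorem relHeight_ne_top {R : Type*} [CommRing R] [IsNoetherianRing R]
    (p q : PrimeSpectrum R) : relHeight p q ≠ ⊤ := by
  refine ne_top_of_le_ne_top ?_ (relHeight_le_height p q)
  have := Ideal.height_ne_top (I := q.asIdeal) q.2.ne_top
  rwa [PrimeSpectrum.height_eq_orderHeight] at this

/-! ### Associated primes, supports and localization -/

section Support

variable {R : Type*} [CommRing R] [IsNoetherianRing R]
  {M : Type*} [AddCommGroup M] [Module R M]

theorem mem_associatedPrimes_iff {p : Ideal R} :
    p ∈ associatedPrimes R M ↔ p.IsPrime ∧ ∃ x : M, ∀ r, r ∈ p ↔ r • x = 0 := by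
  rw [AssociatedPrimes.mem_iff, isAssociatedPrime_iff]
  refine and_congr_right fun _ => exists_congr fun x => ?_
  rw [SetLike.ext_iff]
  simp only [Submodule.mem_colon_singleton, Submodule.mem_bot]

theorem mem_support_of_mem_associatedPrimes {p : PrimeSpectrum R}
    (hp : p.asIdeal ∈ associatedPrimes R M) : p ∈ Module.support R M := by
  obtain ⟨-, x, hx⟩ := mem_associatedPrimes_iff.mp hp
  exact Module.mem_support_iff'.mpr ⟨x, fun r hr h => hr ((hx r).mpr h)⟩

theorem exists_associatedPrime_le_of_mem_support [Module.Finite R M] {q : PrimeSpectrum R}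
    (hq : q ∈ Module.support R M) :
    ∃ p : PrimeSpectrum R, p.asIdeal ∈ associatedPrimes R M ∧ p ≤ q := by
  obtain ⟨p, hp, hpq⟩ := Ideal.exists_minimalPrimes_le (Module.annihilator_le_of_mem_support hq)
  exact ⟨⟨p, hp.1.1⟩,
    Module.associatedPrimes.minimalPrimes_annihilator_subset_associatedPrimes R M hp, hpq⟩

omit [IsNoetherianRing R] in
theorem supportDim_lt_iff {n : ℕ} :
    Module.supportDim R M < n ↔ ∀ p ∈ Module.support R M, Order.coheight p < n := by
  rw [Module.supportDim, Order.krullDim_lt_coe_iff]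
  constructor
  · intro h p hp
    by_contra! hn
    obtain ⟨s, hs, hsn⟩ := Order.exists_series_of_le_coheight _ hn
    let t : LTSeries (Module.support R M) :=
      { length := s.length
        toFun := fun i => ⟨s i, Module.mem_support_mono
          (hs ▸ LTSeries.monotone s (Fin.zero_le i)) hp⟩
        step := fun i => s.step i }
    exact (h t).ne hsn
  · intro h s
    exact_mod_cast (Order.length_le_coheight (p := s.map (fun x => x.1) fun _ _ h => h)
      le_rfl).trans_lt (h _ s.head.2)

omit [IsNoetherianRing R] in
theorem exists_supportDim_eq_natCast [Nontrivial M] {n : ℕ} (h : Module.supportDim R M < n) :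
    ∃ a < n, Module.supportDim R M = a := by
  obtain ⟨e, he⟩ := WithBot.ne_bot_iff_exists.mp (Module.supportDim_ne_bot_of_nontrivial R M)
  rw [← he] at h ⊢
  have hen : e < n := by exact_mod_cast h
  obtain ⟨a, rfl⟩ := ENat.ne_top_iff_exists.mp (lt_top_of_lt hen).ne
  exact ⟨a, by exact_mod_cast hen, rfl⟩

theorem supportDim_lt_iff_associatedPrimes [Module.Finite R M] {n : ℕ} :
    Module.supportDim R M < n ↔
      ∀ p : PrimeSpectrum R, p.asIdeal ∈ associatedPrimes R M → Order.coheight p < n := by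
  rw [supportDim_lt_iff]
  refine ⟨fun h p hp => h p (mem_support_of_mem_associatedPrimes hp), fun h q hq => ?_⟩
  obtain ⟨p, hp, hpq⟩ := exists_associatedPrime_le_of_mem_support hq
  exact (Order.coheight_anti hpq).trans_lt (h p hp)

theorem isSMulRegular_iff_forall_associatedPrimes {x : R} :
    IsSMulRegular M x ↔ ∀ p ∈ associatedPrimes R M, x ∉ p := by
  have hunion := Set.ext_iff.mp (biUnion_associatedPrimes_eq_compl_regular R M) x
  simp only [Set.mem_iUnion, SetLike.mem_coe, Set.mem_compl_iff, Set.mem_ofPred_eq] at hunion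
  rw [← not_iff_not, ← hunion]
  simp only [not_forall, not_not]

end Support

section Localization

variable {R : Type*} [CommRing R] (q : PrimeSpectrum R)
  {A : Type*} [CommRing A] [Algebra R A] [IsLocalization.AtPrime A q.asIdeal]
  {M : Type*} [AddCommGroup M] [Module R M] {M' : Type*} [AddCommGroup M'] [Module R M']
  (f : M →ₗ[R] M') [IsLocalizedModule q.asIdeal.primeCompl f] [Module A M'] [IsScalarTower R A M']

include q in
theorem comap_le_of_isLocalization_atPrime (p : PrimeSpectrum A) :
    PrimeSpectrum.comap (algebraMap R A) p ≤ q :=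
  (IsLocalization.AtPrime.primeSpectrumOrderIso A q.asIdeal p).2

theorem exists_comap_eq_of_le {p : PrimeSpectrum R} (hp : p ≤ q) :
    ∃ p' : PrimeSpectrum A, PrimeSpectrum.comap (algebraMap R A) p' = p := by
  obtain ⟨p', hp'⟩ := (IsLocalization.AtPrime.primeSpectrumOrderIso A q.asIdeal).surjective ⟨p, hp⟩
  exact ⟨p', congrArg Subtype.val hp'⟩

theorem coheight_eq_relHeight_comap (p : PrimeSpectrum A) :
    Order.coheight p = relHeight (PrimeSpectrum.comap (algebraMap R A) p) q := by
  rw [← Order.coheight_orderIso (IsLocalization.AtPrime.primeSpectrumOrderIso A q.asIdeal) p,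
    coheight_Iic_eq_relHeight]
  rfl

include q f in
theorem mem_support_iff_comap_mem_support (p : PrimeSpectrum A) :
    p ∈ Module.support A M' ↔ PrimeSpectrum.comap (algebraMap R A) p ∈ Module.support R M := by
  have hle := comap_le_of_isLocalization_atPrime q p
  rw [Module.mem_support_iff', Module.mem_support_iff']
  constructor
  · rintro ⟨m', hm'⟩
    obtain ⟨⟨m, s⟩, rfl⟩ := IsLocalizedModule.mk'_surjective q.asIdeal.primeCompl f m'
    refine ⟨m, fun r hr h => hm' (algebraMap R A r) hr ?_⟩
    rw [Function.uncurry_apply_pair, algebraMap_smul, ← IsLocalizedModule.mk'_smul, h,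
      IsLocalizedModule.mk'_zero]
  · rintro ⟨m, hm⟩
    refine ⟨f m, fun a ha h => ?_⟩
    obtain ⟨r, s, rfl⟩ := IsLocalization.exists_mk'_eq q.asIdeal.primeCompl a
    have hrm : f (r • m) = 0 := by
      simpa [← mul_smul, algebraMap_smul] using congrArg (algebraMap R A s • ·) h
    obtain ⟨c, hc⟩ := (IsLocalizedModule.eq_zero_iff q.asIdeal.primeCompl f).mp hrm
    refine hm (c * r) (fun hcr => ?_) (by rw [mul_smul]; exact hc)
    rcases (PrimeSpectrum.comap (algebraMap R A) p).2.mem_or_mem hcr with h | h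
    · exact c.2 (hle h)
    · apply ha
      rw [IsLocalization.mk'_eq_mul_mk'_one]
      exact p.asIdeal.mul_mem_right _ h

include q f in
theorem nontrivial_iff_mem_support_of_isLocalizedModule :
    Nontrivial M' ↔ q ∈ Module.support R M := by
  rw [Module.mem_support_iff]
  exact (IsLocalizedModule.linearEquiv q.asIdeal.primeCompl f
    (LocalizedModule.mkLinearMap q.asIdeal.primeCompl M)).toEquiv.nontrivial_congr

open Module.associatedPrimes in
include q f in
theorem mem_associatedPrimes_iff_comap [IsNoetherianRing R] (p : PrimeSpectrum A) :
    p.asIdeal ∈ associatedPrimes A M' ↔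
      (PrimeSpectrum.comap (algebraMap R A) p).asIdeal ∈ associatedPrimes R M := by
  rw [← preimage_comap_associatedPrimes_eq_associatedPrimes_of_isLocalizedModule
    q.asIdeal.primeCompl A f]
  rfl

theorem localized'_smul_top {x : R} {r : A} {u : Aˣ} (hr : r = u * algebraMap R A x) :
    (x • (⊤ : Submodule R M)).localized' A q.asIdeal.primeCompl f = r • (⊤ : Submodule A M') := by
  rw [← Submodule.ideal_span_singleton_smul, ← Submodule.ideal_span_singleton_smul,
    Submodule.localized'_smul, Ideal.localized'_eq_map, Submodule.localized'_top, Ideal.map_span,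
    Set.image_singleton, hr, Ideal.span_singleton_mul_left_unit u.isUnit]

include q in
theorem exists_eq_unit_mul_algebraMap (r : A) :
    ∃ (u : Aˣ) (x : R), r = u * algebraMap R A x := by
  obtain ⟨x, s, rfl⟩ := IsLocalization.exists_mk'_eq q.asIdeal.primeCompl r
  obtain ⟨u, hu⟩ := IsLocalization.map_units A s
  exact ⟨u⁻¹, x, by rw [Units.eq_inv_mul_iff_mul_eq, hu, IsLocalization.mk'_spec']⟩

end Localization

/-! ### Regular sequences -/

section RegularSequence

open RingTheory.Sequence

variable {A : Type*} [CommRing A] {N : Type*} [AddCommGroup N] [Module A N]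

/-- `N` has a regular sequence of length `n` contained in the ideal `I`. -/
def HasRegularSequence (I : Ideal A) (n : ℕ) (N : Type*) [AddCommGroup N] [Module A N] : Prop :=
  ∃ rs : List A, rs.length = n ∧ (∀ r ∈ rs, r ∈ I) ∧ IsRegular N rs

theorem hasRegularSequence_zero_iff {I : Ideal A} :
    HasRegularSequence I 0 N ↔ Nontrivial N :=
  ⟨fun ⟨_, _, _, h⟩ => h.nontrivial, fun _ => ⟨[], rfl, by simp, IsRegular.nil A N⟩⟩

theorem hasRegularSequence_succ_iff {I : Ideal A} {n : ℕ} :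
    HasRegularSequence I (n + 1) N ↔
      ∃ r ∈ I, IsSMulRegular N r ∧ HasRegularSequence I n (QuotSMulTop r N) := by
  constructor
  · rintro ⟨_ | ⟨r, rs⟩, hl, hI, hrs⟩
    · simp at hl
    · rw [List.forall_mem_cons] at hI
      obtain ⟨hr, hrs⟩ := (isRegular_cons_iff N r rs).mp hrs
      exact ⟨r, hI.1, hr, rs, by simpa using hl, hI.2, hrs⟩
  · rintro ⟨r, hrI, hr, rs, rfl, hI, hrs⟩
    exact ⟨r :: rs, rfl, List.forall_mem_cons.mpr ⟨hrI, hI⟩, .cons hr hrs⟩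

theorem hasRegularSequence_congr {N' : Type*} [AddCommGroup N'] [Module A N'] (e : N ≃ₗ[A] N')
    {I : Ideal A} {n : ℕ} : HasRegularSequence I n N ↔ HasRegularSequence I n N' :=
  exists_congr fun rs => and_congr_right fun _ => and_congr_right fun _ => e.isRegular_congr rs

theorem HasRegularSequence.of_succ {I : Ideal A} {n : ℕ} (h : HasRegularSequence I (n + 1) N) :
    HasRegularSequence I n N := by
  induction n generalizing N with
  | zero => exact hasRegularSequence_zero_iff.mpr h.choose_spec.2.2.nontrivial
  | succ n ih =>
    obtain ⟨r, hrI, hr, h⟩ := hasRegularSequence_succ_iff.mp h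
    exact hasRegularSequence_succ_iff.mpr ⟨r, hrI, hr, ih h⟩

theorem le_localDepth_iff [IsLocalRing A] [Nontrivial N] {n : ℕ} :
    n ≤ localDepth A N ↔ HasRegularSequence (IsLocalRing.maximalIdeal A) n N := by
  constructor
  · rcases n with _ | n
    · exact fun _ => hasRegularSequence_zero_iff.mpr inferInstance
    intro h
    obtain ⟨⟨rs, hI, hrs⟩, hlt⟩ := lt_iSup_iff.mp ((Nat.cast_lt.mpr n.lt_succ_self).trans_le h)
    have hn : n + 1 ≤ rs.length := by exact_mod_cast hlt
    exact Nat.decreasingInduction' (fun _ _ _ h => h.of_succ) hn ⟨rs, rfl, hI, hrs⟩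
  · rintro ⟨rs, rfl, hI, hrs⟩
    exact le_iSup (fun rs : {rs : List A // (∀ r ∈ rs, r ∈ IsLocalRing.maximalIdeal A) ∧
      IsRegular N rs} => (rs.1.length : ℕ∞)) ⟨rs, hI, hrs⟩

open CategoryTheory Abelian in
/-- By the theorem of Rees, the depth is the smallest degree in which `Ext (A / 𝔪) N` does not
vanish, and this degree drops by one in the long exact sequence of `0 → N → N → N / x N → 0`. -/
theorem HasRegularSequence.quotSMulTop {A : Type u} [CommRing A] [IsLocalRing A]
    [IsNoetherianRing A] {N : Type (max u v)} [AddCommGroup N] [Module A N] [Module.Finite A N]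
    {n : ℕ} (h : HasRegularSequence (IsLocalRing.maximalIdeal A) (n + 1) N) {x : A}
    (hx : x ∈ IsLocalRing.maximalIdeal A) (hreg : IsSMulRegular N x) :
    HasRegularSequence (IsLocalRing.maximalIdeal A) n (QuotSMulTop x N) := by
  have : Small.{max u v} A := small_lift.{u, max u v} A
  have hN : Nontrivial N := h.choose_spec.2.2.nontrivial
  have hQ : Nontrivial (QuotSMulTop x N) := nontrivial_quotSMulTop_of_mem_maximalIdeal N hx
  have hlt (L : Type (max u v)) [AddCommGroup L] [Module A L] [Module.Finite A L]
      [Nontrivial L] : IsLocalRing.maximalIdeal A • (⊤ : Submodule A L) < ⊤ :=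
    (Submodule.top_ne_ideal_smul_of_le_jacobson_annihilator
      (IsLocalRing.maximalIdeal_le_jacobson _)).symm.lt_top
  have reesN := ModuleCat.exists_isRegular_tfae (IsLocalRing.maximalIdeal A) (n + 1)
    (ModuleCat.of A N) (hlt N)
  have reesQ := ModuleCat.exists_isRegular_tfae (IsLocalRing.maximalIdeal A) n
    (ModuleCat.of A (QuotSMulTop x N)) (hlt (QuotSMulTop x N))
  have hext := (reesN.out 3 1).mp h
  refine (reesQ.out 1 3).mp fun i hi => ?_
  have hext_i := AddCommGrpCat.isZero_of_iff_subsingleton.mpr (hext i (by omega))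
  have hext_succ := AddCommGrpCat.isZero_of_iff_subsingleton.mpr (hext (i + 1) (by omega))
  have hreg' : IsSMulRegular (ModuleCat.of A N) x := hreg
  exact AddCommGrpCat.subsingleton_of_isZero <| ShortComplex.Exact.isZero_of_both_zeros
    ((Ext.covariant_sequence_exact₃' _ hreg'.smulShortComplex_shortExact) i (i + 1) rfl)
    (hext_i.eq_zero_of_src _) (hext_succ.eq_zero_of_tgt _)

theorem eq_bot_of_torsionBySet_le_smul_top [IsLocalRing A] [IsNoetherianRing A]
    [Module.Finite A N] {x : A} (hx : x ∈ IsLocalRing.maximalIdeal A) (hreg : IsSMulRegular N x)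
    {s : Set A} (h : Submodule.torsionBySet A N s ≤ x • (⊤ : Submodule A N)) :
    Submodule.torsionBySet A N s = ⊥ := by
  refine Submodule.eq_bot_of_le_smul_of_le_jacobson_bot (IsLocalRing.maximalIdeal A) _
    (IsNoetherian.noetherian _) (fun z hz => ?_) (IsLocalRing.maximalIdeal_le_jacobson _)
  obtain ⟨w, -, rfl⟩ := (Submodule.mem_smul_pointwise_iff_exists z x ⊤).mp (h hz)
  refine Submodule.smul_mem_smul hx ((Submodule.mem_torsionBySet_iff _ _).mpr fun a => ?_)
  refine hreg.right_eq_zero_of_smul ?_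
  rw [smul_comm]
  exact (Submodule.mem_torsionBySet_iff _ _).mp hz a

theorem exists_associatedPrime_quotSMulTop_gt [IsLocalRing A] [IsNoetherianRing A]
    [Module.Finite A N] {x : A} (hx : x ∈ IsLocalRing.maximalIdeal A) (hreg : IsSMulRegular N x)
    {p : Ideal A} (hp : p ∈ associatedPrimes A N) :
    ∃ p' ∈ associatedPrimes A (QuotSMulTop x N), p < p' := by
  obtain ⟨hprime, y, hy⟩ := mem_associatedPrimes_iff.mp hp
  have hne : Submodule.torsionBySet A N p ≠ ⊥ := fun hbot => by
    have hy0 : y ∈ Submodule.torsionBySet A N p :=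
      (Submodule.mem_torsionBySet_iff _ _).mpr fun a => (hy a).mp a.2
    rw [hbot, Submodule.mem_bot] at hy0
    exact hprime.one_notMem ((hy 1).mpr (by rw [hy0, smul_zero]))
  obtain ⟨z, hzp, hz⟩ := SetLike.not_le_iff_exists.mp
    (mt (eq_bot_of_torsionBySet_le_smul_top hx hreg) hne)
  have hz' : (Submodule.Quotient.mk z : QuotSMulTop x N) ≠ 0 := by
    rwa [Ne, Submodule.Quotient.mk_eq_zero]
  obtain ⟨p', hp', hle⟩ := exists_le_isAssociatedPrime_of_isNoetherianRing A _ hz'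
  have hmem (a : A) (ha : a • z ∈ x • (⊤ : Submodule A N)) : a ∈ p' := hle <| by
    rw [Submodule.mem_colon_singleton, ← Submodule.Quotient.mk_smul]
    exact (Submodule.Quotient.mk_eq_zero _).mpr ha
  have hpp' : p ≤ p' := fun a ha => hmem a <| by
    rw [(Submodule.mem_torsionBySet_iff _ _).mp hzp ⟨a, ha⟩]
    exact zero_mem _
  refine ⟨p', hp', lt_of_le_of_ne hpp' ?_⟩
  rintro rfl
  exact isSMulRegular_iff_forall_associatedPrimes.mp hreg _ hp
    (hmem x (Submodule.smul_mem_pointwise_smul z x ⊤ trivial))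

end RegularSequence

/-! ### Depth and Cohen-Macaulayness at a prime -/

section DepthAt

variable {R : Type*} [CommRing R]

/-- The image of `x` in `R_q` is a nonzerodivisor on `M_q` (over a Noetherian ring); this is
phrased over `R` so that it can be compared for different primes `q`. -/
def IsRegularAt (M : Type*) [AddCommGroup M] [Module R M] (q : PrimeSpectrum R) (x : R) : Prop :=
  ∀ p : PrimeSpectrum R, p.asIdeal ∈ associatedPrimes R M → p ≤ q → x ∉ p.asIdeal

/-- The localization `M_q` has a regular sequence of length `n` in the maximal ideal of `R_q`; this
is phrased over `R` so that it can be compared for different primes `q`. -/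
def HasDepthAt (q : PrimeSpectrum R) :
    ℕ → ∀ (M : Type*) [AddCommGroup M] [Module R M], Prop
  | 0, M, _, _ => q ∈ Module.support R M
  | n + 1, M, _, _ => ∃ x ∈ q.asIdeal, IsRegularAt M q x ∧ HasDepthAt q n (QuotSMulTop x M)

/-- The localization `M_q` is a Cohen-Macaulay module of dimension `n`. -/
def IsCMAt (M : Type*) [AddCommGroup M] [Module R M] (q : PrimeSpectrum R) (n : ℕ) : Prop :=
  HasDepthAt q n M ∧ ∀ p ∈ Module.support R M, p ≤ q → relHeight p q ≤ n

theorem IsRegularAt.of_le {M : Type*} [AddCommGroup M] [Module R M] {p q : PrimeSpectrum R} {x : R}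
    (hx : IsRegularAt M q x) (hpq : p ≤ q) : IsRegularAt M p x :=
  fun _ hp' hle => hx _ hp' (hle.trans hpq)

end DepthAt

section DepthAtLocalization

variable {R : Type*} [CommRing R] [IsNoetherianRing R] (q : PrimeSpectrum R)
  {A : Type*} [CommRing A] [Algebra R A] [IsLocalization.AtPrime A q.asIdeal]
  {M : Type*} [AddCommGroup M] [Module R M] {M' : Type*} [AddCommGroup M'] [Module R M']
  (f : M →ₗ[R] M') [IsLocalizedModule q.asIdeal.primeCompl f] [Module A M'] [IsScalarTower R A M']

include q f in
theorem isSMulRegular_algebraMap_iff_isRegularAt (x : R) :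
    IsSMulRegular M' (algebraMap R A x) ↔ IsRegularAt M q x := by
  have : IsNoetherianRing A := IsLocalization.isNoetherianRing q.asIdeal.primeCompl A inferInstance
  rw [isSMulRegular_iff_forall_associatedPrimes]
  constructor
  · intro h p hp hpq hx
    obtain ⟨p', rfl⟩ := exists_comap_eq_of_le (A := A) q hpq
    exact h p'.asIdeal ((mem_associatedPrimes_iff_comap q f p').mpr hp) hx
  · intro h p hp hx
    exact h _ ((mem_associatedPrimes_iff_comap q f ⟨p, hp.isPrime⟩).mp hp)
      (comap_le_of_isLocalization_atPrime q _) hx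

include f in
theorem hasDepthAt_iff_hasRegularSequence [IsLocalRing A] (n : ℕ) :
    HasDepthAt q n M ↔ HasRegularSequence (IsLocalRing.maximalIdeal A) n M' := by
  induction n generalizing M M' with
  | zero =>
    rw [HasDepthAt, hasRegularSequence_zero_iff,
      nontrivial_iff_mem_support_of_isLocalizedModule q f]
  | succ n ih =>
    have hquot {x : R} {r : A} {u : Aˣ} (hr : r = u * algebraMap R A x) :
        HasDepthAt q n (QuotSMulTop x M) ↔
          HasRegularSequence (IsLocalRing.maximalIdeal A) n (QuotSMulTop r M') := by
      rw [ih ((x • (⊤ : Submodule R M)).toLocalizedQuotient' A q.asIdeal.primeCompl f)]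
      exact hasRegularSequence_congr (Submodule.quotEquivOfEq _ _ (localized'_smul_top q f hr))
    rw [HasDepthAt, hasRegularSequence_succ_iff]
    constructor
    · rintro ⟨x, hx, hreg, h⟩
      exact ⟨algebraMap R A x, (IsLocalization.AtPrime.to_map_mem_maximal_iff A q.asIdeal x).mpr hx,
        (isSMulRegular_algebraMap_iff_isRegularAt q f x).mpr hreg, (hquot (u := 1) (by simp)).mp h⟩
    · rintro ⟨r, hrA, hreg, h⟩
      obtain ⟨u, x, hr⟩ := exists_eq_unit_mul_algebraMap q r
      have hx : algebraMap R A x = ↑u⁻¹ * r := by rw [hr, Units.inv_mul_cancel_left]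
      refine ⟨x, ?_, ?_, (hquot hr).mpr h⟩
      · rw [← IsLocalization.AtPrime.to_map_mem_maximal_iff A q.asIdeal x, hx]
        exact Ideal.mul_mem_left _ _ hrA
      · rw [← isSMulRegular_algebraMap_iff_isRegularAt (A := A) q f x, hx]
        exact (u⁻¹.isUnit.isSMulRegular M').mul hreg

omit [IsNoetherianRing R] in
include q f in
theorem supportDim_atPrime_lt_iff {n : ℕ} : Module.supportDim A M' < n ↔
    ∀ p ∈ Module.support R M, p ≤ q → relHeight p q < n := by
  rw [supportDim_lt_iff]
  constructor
  · intro h p hp hpq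
    obtain ⟨P, rfl⟩ := exists_comap_eq_of_le (A := A) q hpq
    rw [← coheight_eq_relHeight_comap]
    exact h P ((mem_support_iff_comap_mem_support q f P).mpr hp)
  · intro h P hP
    rw [coheight_eq_relHeight_comap q]
    exact h _ ((mem_support_iff_comap_mem_support q f P).mp hP)
      (comap_le_of_isLocalization_atPrime q P)

omit [IsNoetherianRing R] in
include q f in
theorem supportDim_atPrime_le_iff {n : ℕ} : Module.supportDim A M' ≤ n ↔
    ∀ p ∈ Module.support R M, p ≤ q → relHeight p q ≤ n := by
  rw [← ENat.WithBot.lt_add_one_iff, ← Nat.cast_succ, supportDim_atPrime_lt_iff q f]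
  simp only [Nat.cast_succ, ENat.lt_add_one_iff (ENat.natCast_ne_top n)]

end DepthAtLocalization

section CohenMacaulayAt

variable {R : Type u} [CommRing R] [IsNoetherianRing R] {q : PrimeSpectrum R}
  {M : Type v} [AddCommGroup M] [Module R M] [Module.Finite R M]

theorem HasDepthAt.quotSMulTop {n : ℕ} (h : HasDepthAt q (n + 1) M) {x : R} (hxq : x ∈ q.asIdeal)
    (hx : IsRegularAt M q x) : HasDepthAt q n (QuotSMulTop x M) := by
  let A := Localization.AtPrime q.asIdeal
  let f := LocalizedModule.mkLinearMap q.asIdeal.primeCompl M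
  rw [hasDepthAt_iff_hasRegularSequence (A := A) q f] at h
  rw [hasDepthAt_iff_hasRegularSequence (A := A) q
      ((x • (⊤ : Submodule R M)).toLocalizedQuotient' A q.asIdeal.primeCompl f),
    hasRegularSequence_congr (Submodule.quotEquivOfEq _ _
      (localized'_smul_top (x := x) (r := algebraMap R A x) (u := 1) q f (by simp)))]
  exact HasRegularSequence.quotSMulTop.{u, v} h
    ((IsLocalization.AtPrime.to_map_mem_maximal_iff A q.asIdeal x).mpr hxq)
    ((isSMulRegular_algebraMap_iff_isRegularAt q f x).mpr hx)

theorem IsRegularAt.exists_associatedPrime_gt {x : R} (hx : IsRegularAt M q x)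
    (hxq : x ∈ q.asIdeal) {p : PrimeSpectrum R} (hp : p.asIdeal ∈ associatedPrimes R M)
    (hpq : p ≤ q) :
    ∃ p' : PrimeSpectrum R,
      p'.asIdeal ∈ associatedPrimes R (QuotSMulTop x M) ∧ p < p' ∧ p' ≤ q := by
  let A := Localization.AtPrime q.asIdeal
  let f := LocalizedModule.mkLinearMap q.asIdeal.primeCompl M
  obtain ⟨P, rfl⟩ := exists_comap_eq_of_le (A := A) q hpq
  obtain ⟨P', hP', hlt⟩ := exists_associatedPrime_quotSMulTop_gt
    ((IsLocalization.AtPrime.to_map_mem_maximal_iff A q.asIdeal x).mpr hxq)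
    ((isSMulRegular_algebraMap_iff_isRegularAt q f x).mpr hx)
    ((mem_associatedPrimes_iff_comap q f P).mpr hp)
  let Q : PrimeSpectrum A := ⟨P', hP'.isPrime⟩
  rw [← LinearEquiv.AssociatedPrimes.eq (Submodule.quotEquivOfEq _ _
    (localized'_smul_top (x := x) (r := algebraMap R A x) (u := 1) q f (by simp)))] at hP'
  refine ⟨PrimeSpectrum.comap (algebraMap R A) Q, ?_, ?_, comap_le_of_isLocalization_atPrime q Q⟩
  · exact (mem_associatedPrimes_iff_comap q ((x • (⊤ : Submodule R M)).toLocalizedQuotient' A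
      q.asIdeal.primeCompl f) Q).mp hP'
  · exact (IsLocalization.AtPrime.primeSpectrumOrderIso A q.asIdeal).strictMono
      (show P < Q from hlt)

omit [IsNoetherianRing R] in
theorem HasDepthAt.mem_support {n : ℕ} (h : HasDepthAt q n M) : q ∈ Module.support R M := by
  induction n generalizing M with
  | zero => exact h
  | succ n ih =>
    obtain ⟨x, -, -, h⟩ := h
    have hq := ih h
    rw [Module.support_quotSMulTop] at hq
    exact hq.1

theorem HasDepthAt.le_relHeight {n : ℕ} (h : HasDepthAt q n M) {p : PrimeSpectrum R}
    (hp : p.asIdeal ∈ associatedPrimes R M) (hpq : p ≤ q) : n ≤ relHeight p q := by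
  induction n generalizing M p with
  | zero => simp
  | succ n ih =>
    obtain ⟨x, hxq, hx, h⟩ := h
    obtain ⟨p', hp', hlt, hle⟩ := hx.exists_associatedPrime_gt hxq hp hpq
    calc ((n + 1 : ℕ) : ℕ∞) = n + 1 := by push_cast; rfl
      _ ≤ relHeight p' q + 1 := by gcongr; exact ih h hp' hle
      _ ≤ relHeight p q := relHeight_add_one_le_of_lt_left hlt hle

theorem IsCMAt.relHeight_eq {n : ℕ} (h : IsCMAt M q n) {p : PrimeSpectrum R}
    (hp : p.asIdeal ∈ associatedPrimes R M) (hpq : p ≤ q) : relHeight p q = n :=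
  le_antisymm (h.2 p (mem_support_of_mem_associatedPrimes hp) hpq) (h.1.le_relHeight hp hpq)

theorem exists_mem_isRegularAt_of_le {m : PrimeSpectrum R}
    (hq : ∀ p : PrimeSpectrum R, p.asIdeal ∈ associatedPrimes R M → p ≤ m → ¬ q ≤ p) :
    ∃ x ∈ q.asIdeal, IsRegularAt M m x := by
  let s : Set (Ideal R) := {p ∈ associatedPrimes R M | p ≤ m.asIdeal}
  have hs : s.Finite := (associatedPrimes.finite R M).subset fun _ h => h.1
  obtain ⟨x, hxq, hx⟩ := Set.not_subset.mp <| mt (Ideal.subset_union_prime_finite hs (f := id)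
    (I := q.asIdeal) ⊥ ⊥ fun p hp _ _ => hp.1.isPrime).mp
      fun ⟨p, hp, hqp⟩ => hq ⟨p, hp.1.isPrime⟩ hp.1 hp.2 hqp
  exact ⟨x, hxq, fun p hp hpm hxp => hx (Set.mem_biUnion (x := p.asIdeal) ⟨hp, hpm⟩ hxp)⟩

theorem exists_mem_isRegularAt (hq : q.asIdeal ∉ associatedPrimes R M) :
    ∃ x ∈ q.asIdeal, IsRegularAt M q x :=
  exists_mem_isRegularAt_of_le fun _ hp hle hle' => hq (le_antisymm hle' hle ▸ hp)

theorem IsCMAt.eq_of_mem_associatedPrimes_of_le {n : ℕ} (h : IsCMAt M q n) {p p' : PrimeSpectrum R}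
    (hp : p.asIdeal ∈ associatedPrimes R M) (hp' : p'.asIdeal ∈ associatedPrimes R M)
    (hle : p ≤ p') (hq : p' ≤ q) : p = p' := by
  refine hle.eq_of_not_lt fun hlt => ?_
  have hht := relHeight_add_one_le_of_lt_left hlt hq
  rw [h.relHeight_eq hp (hle.trans hq), h.relHeight_eq hp' hq] at hht
  exact absurd hht (by norm_cast; omega)

theorem IsCMAt.quotSMulTop {n : ℕ} (h : IsCMAt M q (n + 1)) {x : R} (hxq : x ∈ q.asIdeal)
    (hx : IsRegularAt M q x) : IsCMAt (QuotSMulTop x M) q n := by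
  refine ⟨h.1.quotSMulTop hxq hx, fun p hp hpq => ?_⟩
  rw [Module.support_quotSMulTop] at hp
  obtain ⟨p₀, hp₀, hp₀p⟩ := exists_associatedPrime_le_of_mem_support hp.1
  have hlt : p₀ < p := lt_of_le_of_ne hp₀p fun heq =>
    hx _ hp₀ (hp₀p.trans hpq) (heq ▸ hp.2 rfl)
  have hht := relHeight_add_one_le_of_lt_left hlt hpq
  rw [h.relHeight_eq hp₀ (hp₀p.trans hpq), Nat.cast_succ] at hht
  exact (ENat.add_le_add_iff_right ENat.one_ne_top).mp hht

omit [Module.Finite R M] in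
theorem IsCMAt.of_hasDepthAt_of_le {m : PrimeSpectrum R} {n k : ℕ} (h : IsCMAt M m n) (hqm : q ≤ m)
    (hk : HasDepthAt q k M) (hkn : k + relHeight q m = n) : IsCMAt M q k := by
  refine ⟨hk, fun p hp hpq => ?_⟩
  have hle := (relHeight_add_le hpq hqm).trans (h.2 p hp (hpq.trans hqm))
  rw [← hkn] at hle
  exact (ENat.add_le_add_iff_right (relHeight_ne_top q m)).mp hle

theorem IsCMAt.exists_of_le {m : PrimeSpectrum R} {n : ℕ} (h : IsCMAt M m n) (hqm : q ≤ m)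
    (hq : q ∈ Module.support R M) : ∃ k : ℕ, IsCMAt M q k ∧ k + relHeight q m = n := by
  suffices ∃ k : ℕ, HasDepthAt q k M ∧ k + relHeight q m = n by
    obtain ⟨k, hk, hkn⟩ := this
    exact ⟨k, h.of_hasDepthAt_of_le hqm hk hkn, hkn⟩
  induction n generalizing M with
  | zero => exact ⟨0, hq, by simpa using h.2 q hq hqm⟩
  | succ n ih =>
    by_cases hass : q.asIdeal ∈ associatedPrimes R M
    · exact ⟨0, hq, by simp [h.relHeight_eq hass hqm]⟩
    have hnot (p : PrimeSpectrum R) (hp : p.asIdeal ∈ associatedPrimes R M) (hpm : p ≤ m) :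
        ¬ q ≤ p := fun hqp => by
      obtain ⟨p₀, hp₀, hp₀q⟩ := exists_associatedPrime_le_of_mem_support hq
      have heq := h.eq_of_mem_associatedPrimes_of_le hp₀ hp (hp₀q.trans hqp) hpm
      exact hass (le_antisymm hqp (heq ▸ hp₀q) ▸ hp)
    obtain ⟨x, hxq, hx⟩ := exists_mem_isRegularAt_of_le hnot
    have hsupp : q ∈ Module.support R (QuotSMulTop x M) := by
      rw [Module.support_quotSMulTop]
      exact ⟨hq, by simpa using hxq⟩
    obtain ⟨k, hk, hkn⟩ := ih (h.quotSMulTop (hqm hxq) hx) hsupp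
    exact ⟨k + 1, ⟨x, hxq, hx.of_le hqm, hk⟩, by push_cast; rw [← hkn]; ring⟩

section Localization

variable (q) {A : Type*} [CommRing A] [Algebra R A] [IsLocalization.AtPrime A q.asIdeal]
  {M' : Type*} [AddCommGroup M'] [Module R M'] (f : M →ₗ[R] M')
  [IsLocalizedModule q.asIdeal.primeCompl f] [Module A M'] [IsScalarTower R A M']

include q f in
theorem IsCMAt.localDepth_eq [IsLocalRing A] {n : ℕ} (h : IsCMAt M q n) : localDepth A M' = n := by
  have : Nontrivial M' :=
    (nontrivial_iff_mem_support_of_isLocalizedModule q f).mpr h.1.mem_support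
  obtain ⟨p, hp, hpq⟩ := exists_associatedPrime_le_of_mem_support h.1.mem_support
  refine le_antisymm (ENat.forall_natCast_le_iff_le.mp fun k hk => ?_) ?_
  · rw [le_localDepth_iff, ← hasDepthAt_iff_hasRegularSequence q f] at hk
    exact (hk.le_relHeight hp hpq).trans_eq (h.relHeight_eq hp hpq)
  · rw [le_localDepth_iff, ← hasDepthAt_iff_hasRegularSequence q f]
    exact h.1

include q f in
theorem IsCMAt.supportDim_eq {n : ℕ} (h : IsCMAt M q n) : Module.supportDim A M' = n := by
  obtain ⟨p, hp, hpq⟩ := exists_associatedPrime_le_of_mem_support h.1.mem_support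
  refine le_antisymm ((supportDim_atPrime_le_iff q f).mpr h.2) (not_lt.mp fun hlt => ?_)
  exact ((supportDim_atPrime_lt_iff q f).mp hlt p (mem_support_of_mem_associatedPrimes hp)
    hpq).ne (h.relHeight_eq hp hpq)

include q f in
theorem localDepth_eq_supportDim_iff [IsLocalRing A] (hq : q ∈ Module.support R M) :
    (localDepth A M' : WithBot ℕ∞) = Module.supportDim A M' ↔ ∃ n, IsCMAt M q n := by
  refine ⟨fun h => ?_, fun ⟨n, hn⟩ => by rw [hn.localDepth_eq q f, hn.supportDim_eq q f]; rfl⟩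
  have : Nontrivial M' := (nontrivial_iff_mem_support_of_isLocalizedModule q f).mpr hq
  have : IsNoetherianRing A := IsLocalization.isNoetherianRing q.asIdeal.primeCompl A inferInstance
  obtain ⟨H, hH⟩ := ENat.ne_top_iff_exists.mp (Ideal.height_ne_top (I := q.asIdeal) q.2.ne_top)
  rw [PrimeSpectrum.height_eq_orderHeight] at hH
  have hle : Module.supportDim A M' ≤ H :=
    (supportDim_atPrime_le_iff q f).mpr fun p _ _ => hH ▸ relHeight_le_height p q
  obtain ⟨d, -, hd⟩ := exists_supportDim_eq_natCast
    (hle.trans_lt (by exact_mod_cast H.lt_succ_self))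
  rw [hd] at h
  refine ⟨d, ?_, (supportDim_atPrime_le_iff q f).mp hd.le⟩
  rw [hasDepthAt_iff_hasRegularSequence (A := A) q f, ← le_localDepth_iff]
  exact_mod_cast h.ge

end Localization

theorem IsCohenMacaulayModule.of_subsingleton (R : Type*) [CommRing R] (M : Type*) [AddCommGroup M]
    [Module R M] [Subsingleton M] : IsCohenMacaulayModule R M := fun m hm => by
  simp [Module.support_eq_empty] at hm

theorem isCohenMacaulayModule_iff : IsCohenMacaulayModule R M ↔
    ∀ m ∈ Module.support R M, m.asIdeal.IsMaximal → ∃ n, IsCMAt M m n :=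
  forall₃_congr fun m hm _ =>
    localDepth_eq_supportDim_iff m (LocalizedModule.mkLinearMap m.asIdeal.primeCompl M) hm

theorem IsCohenMacaulayModule.exists_isCMAt (h : IsCohenMacaulayModule R M)
    (hq : q ∈ Module.support R M) : ∃ n, IsCMAt M q n := by
  obtain ⟨m, hm, hle⟩ := Ideal.exists_le_maximal q.asIdeal q.2.ne_top
  have hqm : q ≤ ⟨m, hm.isPrime⟩ := hle
  obtain ⟨n, hn⟩ := isCohenMacaulayModule_iff.mp h _ (Module.mem_support_mono hqm hq) hm
  obtain ⟨k, hk, -⟩ := hn.exists_of_le hqm hq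
  exact ⟨k, hk⟩

theorem isCohenMacaulayModule_iff_of_isLocalRing [IsLocalRing R] [Nontrivial M] :
    IsCohenMacaulayModule R M ↔ (localDepth R M : WithBot ℕ∞) = Module.supportDim R M := by
  let m := IsLocalRing.closedPoint R
  have hm : m ∈ Module.support R M := IsLocalRing.closedPoint_mem_support R M
  have hunit (x : R) (hx : x ∈ m.asIdeal.primeCompl) : IsUnit x :=
    IsLocalRing.notMem_maximalIdeal.mp hx
  have : IsLocalization.AtPrime R m.asIdeal := IsLocalization.of_le_isUnit hunit
  have : IsLocalizedModule m.asIdeal.primeCompl (LinearMap.id : M →ₗ[R] M) :=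
    isLocalizedModule_id _ M R
  rw [isCohenMacaulayModule_iff, localDepth_eq_supportDim_iff m (LinearMap.id : M →ₗ[R] M) hm]
  refine ⟨fun h => h m hm (IsLocalRing.maximalIdeal.isMaximal R), fun h p _ hp => ?_⟩
  rwa [show p = m from PrimeSpectrum.ext (IsLocalRing.eq_maximalIdeal hp)]

theorem isCohenMacaulayModule_atPrime_iff (q : PrimeSpectrum R) {A : Type*} [CommRing A]
    [Algebra R A] [IsLocalization.AtPrime A q.asIdeal] {M' : Type*} [AddCommGroup M']
    [Module R M'] (f : M →ₗ[R] M') [IsLocalizedModule q.asIdeal.primeCompl f] [Module A M']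
    [IsScalarTower R A M'] :
    IsCohenMacaulayModule A M' ↔ (q ∈ Module.support R M → ∃ n, IsCMAt M q n) := by
  have : IsLocalRing A := IsLocalization.AtPrime.isLocalRing A q.asIdeal
  have : IsNoetherianRing A := IsLocalization.isNoetherianRing q.asIdeal.primeCompl A inferInstance
  have : Module.Finite A M' := Module.Finite.of_isLocalizedModule q.asIdeal.primeCompl f
  rw [← nontrivial_iff_mem_support_of_isLocalizedModule q f]
  rcases subsingleton_or_nontrivial M' with hM' | hM'
  · exact iff_of_true (.of_subsingleton A M') fun h => (not_nontrivial M' h).elim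
  · rw [isCohenMacaulayModule_iff_of_isLocalRing, localDepth_eq_supportDim_iff q f
      ((nontrivial_iff_mem_support_of_isLocalizedModule q f).mp hM')]
    exact ⟨fun h _ => h, fun h => h hM'⟩

end CohenMacaulayAt

/-! ### The filtration by dimension indexed by the natural numbers -/

section DimSub

variable (R : Type*) [CommRing R] (M : Type*) [AddCommGroup M] [Module R M]

/-- The largest submodule of `M` of dimension smaller than `n`. Its elements are described as the
ones which vanish in `M_p` for all primes `p` with `dim R/p ≥ n`. -/
def dimSub (n : ℕ) : Submodule R M where
  carrier := {x | ∀ p : PrimeSpectrum R, n ≤ Order.coheight p → ∃ r ∉ p.asIdeal, r • x = 0}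
  zero_mem' := fun p _ => ⟨1, p.2.one_notMem, smul_zero _⟩
  add_mem' := by
    intro x y hx hy p hp
    obtain ⟨r, hr, hrx⟩ := hx p hp
    obtain ⟨s, hs, hsy⟩ := hy p hp
    refine ⟨r * s, fun h => (p.2.mem_or_mem h).elim hr hs, ?_⟩
    rw [smul_add, mul_smul, mul_smul, hsy, smul_zero, smul_comm, hrx, smul_zero, add_zero]
  smul_mem' := by
    intro c x hx p hp
    obtain ⟨r, hr, hrx⟩ := hx p hp
    exact ⟨r, hr, by rw [smul_comm, hrx, smul_zero]⟩

/-- The `n`-th quotient of the filtration by dimension. It vanishes or is, for exactly one `i`, the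
quotient `D_i / D_{i-1}` of the dimension filtration, namely for the `i` with `d_i = n`. -/
abbrev DimQuot (n : ℕ) : Type _ :=
  dimSub R M (n + 1) ⧸ (dimSub R M n).submoduleOf (dimSub R M (n + 1))

variable {R M}

theorem le_dimSub_iff {n : ℕ} {N : Submodule R M} :
    N ≤ dimSub R M n ↔ Module.supportDim R N < n := by
  rw [supportDim_lt_iff]
  constructor
  · intro h p
    contrapose!
    intro hn
    rw [Module.notMem_support_iff']
    intro m
    obtain ⟨r, hr, hrm⟩ := h m.2 p hn
    exact ⟨r, hr, Subtype.ext hrm⟩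
  · intro h x hx p hn
    obtain ⟨r, hr, hrm⟩ := Module.notMem_support_iff'.mp (fun hp => (h p hp).not_ge hn) ⟨x, hx⟩
    exact ⟨r, hr, congrArg Subtype.val hrm⟩

theorem supportDim_dimSub_lt (n : ℕ) : Module.supportDim R (dimSub R M n) < n :=
  le_dimSub_iff.mp le_rfl

theorem le_dimSub_succ_iff {n : ℕ} {N : Submodule R M} :
    N ≤ dimSub R M (n + 1) ↔ Module.supportDim R N ≤ n := by
  rw [le_dimSub_iff, Nat.cast_succ, ENat.WithBot.lt_add_one_iff]

theorem dimSub_mono : Monotone (dimSub R M) := fun _ _ h _ hx p hp =>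
  hx p (le_trans (by exact_mod_cast h) hp)

theorem dimSub_eq_top_iff {n : ℕ} : dimSub R M n = ⊤ ↔ Module.supportDim R M < n := by
  rw [← top_le_iff, le_dimSub_iff, Module.supportDim_eq_of_equiv Submodule.topEquiv]

theorem dimSub_eq_of_forall_notMem_submoduleDims {m n : ℕ} (hmn : m ≤ n)
    (h : ∀ k : ℕ, m ≤ k → k < n → (k : WithBot ℕ∞) ∉ submoduleDims R M) :
    dimSub R M n = dimSub R M m := by
  refine le_antisymm ?_ (dimSub_mono hmn)
  rcases eq_or_ne (dimSub R M n) ⊥ with hbot | hbot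
  · exact hbot ▸ bot_le
  have : Nontrivial (dimSub R M n) := Submodule.nontrivial_iff_ne_bot.mpr hbot
  obtain ⟨a, han, ha⟩ := exists_supportDim_eq_natCast (supportDim_dimSub_lt (R := R) (M := M) n)
  have ham : a < m := not_le.mp fun hma => h a hma han ⟨_, hbot, ha⟩
  rw [le_dimSub_iff, ha]
  exact_mod_cast ham

theorem dimSub_zero : dimSub R M 0 = ⊥ := by
  by_contra hbot
  have : Nontrivial (dimSub R M 0) := Submodule.nontrivial_iff_ne_bot.mpr hbot
  obtain ⟨a, ha, -⟩ := exists_supportDim_eq_natCast (supportDim_dimSub_lt (R := R) (M := M) 0)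
  exact a.not_lt_zero ha

theorem exists_mem_associatedPrimes_subquotient {F : ℕ → Submodule R M} (hmono : Monotone F)
    (h0 : F 0 = ⊥) {p : Ideal R} {n : ℕ} (hp : p ∈ associatedPrimes R (F n)) :
    ∃ k < n, p ∈ associatedPrimes R (F (k + 1) ⧸ (F k).submoduleOf (F (k + 1))) := by
  induction n with
  | zero =>
    have : Subsingleton (F 0) := Submodule.subsingleton_iff_eq_bot.mpr h0
    rw [associatedPrimes.eq_empty_of_subsingleton] at hp
    exact hp.elim
  | succ n ih =>
    have hexact : Function.Exact (Submodule.inclusion (hmono n.le_succ))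
        ((F n).submoduleOf (F (n + 1))).mkQ := by
      rw [LinearMap.exact_iff, Submodule.ker_mkQ, Submodule.range_inclusion, Submodule.submoduleOf]
    rcases associatedPrimes.subset_union_of_exact (Submodule.inclusion_injective _) hexact hp
      with hp | hp
    · obtain ⟨k, hk, hpk⟩ := ih hp
      exact ⟨k, hk.trans n.lt_succ_self, hpk⟩
    · exact ⟨n, n.lt_succ_self, hp⟩

section Noetherian

variable [IsNoetherianRing R]

theorem coheight_eq_of_mem_associatedPrimes_dimQuot {n : ℕ} {p : PrimeSpectrum R}
    (hp : p.asIdeal ∈ associatedPrimes R (DimQuot R M n)) : Order.coheight p = n := by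
  apply le_antisymm
  · have hlt := supportDim_lt_iff.mp (supportDim_dimSub_lt (M := M) (n + 1)) p
      (Module.support_subset_of_surjective _ (Submodule.mkQ_surjective _)
        (mem_support_of_mem_associatedPrimes hp))
    rwa [Nat.cast_succ, ENat.lt_add_one_iff (ENat.natCast_ne_top n)] at hlt
  by_contra! hlt
  obtain ⟨-, x, hx⟩ := mem_associatedPrimes_iff.mp hp
  obtain ⟨y, rfl⟩ := Submodule.mkQ_surjective _ x
  have hmem (r : R) : r ∈ p.asIdeal ↔ r • (y : M) ∈ dimSub R M n := by
    rw [hx, ← map_smul, Submodule.mkQ_apply, Submodule.Quotient.mk_eq_zero]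
    rfl
  have hy : (y : M) ∈ dimSub R M n := fun p' hp' => by
    obtain ⟨a, ha, ha'⟩ : ∃ a ∈ p.asIdeal, a ∉ p'.asIdeal := Set.not_subset.mp fun hle =>
      (hlt.trans_le hp').not_ge (Order.coheight_anti (show p ≤ p' from hle))
    obtain ⟨r, hr, hra⟩ := (hmem a).mp ha p' hp'
    exact ⟨r * a, fun h => (p'.2.mem_or_mem h).elim hr ha', by rw [mul_smul, hra]⟩
  exact p.2.one_notMem ((hmem 1).mpr (by rwa [one_smul]))

variable {F : ℕ → Submodule R M} (hmono : Monotone F)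
  (hF : ∀ n, ∀ p : PrimeSpectrum R, p.asIdeal ∈ associatedPrimes R
    (F (n + 1) ⧸ (F n).submoduleOf (F (n + 1))) → Order.coheight p = n)

include hmono hF in
theorem le_dimSub_of_coheight_eq [Module.Finite R M] (h0 : F 0 = ⊥) (n : ℕ) :
    F n ≤ dimSub R M n := by
  rw [le_dimSub_iff, supportDim_lt_iff_associatedPrimes]
  intro p hp
  obtain ⟨k, hkn, hk⟩ := exists_mem_associatedPrimes_subquotient hmono h0 hp
  rw [hF k p hk]
  exact_mod_cast hkn

include hmono hF in
theorem dimSub_le_of_coheight_eq {N : ℕ} (hN : F N = ⊤) (n : ℕ) :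
    dimSub R M n ≤ F n := by
  have hdescend (k : ℕ) (hk : n ≤ k) (h : dimSub R M n ≤ F (k + 1)) : dimSub R M n ≤ F k := by
    intro x hx
    by_contra hxk
    have hne : ((F k).submoduleOf (F (k + 1))).mkQ ⟨x, h hx⟩ ≠ 0 := by
      rwa [Ne, Submodule.mkQ_apply, Submodule.Quotient.mk_eq_zero]
    obtain ⟨p, hp, hle⟩ := exists_le_isAssociatedPrime_of_isNoetherianRing R _ hne
    obtain ⟨r, hr, hrx⟩ := hx ⟨p, hp.isPrime⟩ (by rw [hF k ⟨p, hp.isPrime⟩ hp]; exact_mod_cast hk)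
    refine hr (hle ?_)
    rw [Submodule.mem_colon_singleton, ← map_smul, show r • (⟨x, h hx⟩ : F (k + 1)) = 0 from
      Subtype.ext hrx, map_zero]
    exact zero_mem _
  refine Nat.decreasingInduction' (P := fun k => dimSub R M n ≤ F k)
    (fun k _ hk h => hdescend k hk h) (Nat.le_add_left n N) ?_
  rw [eq_top_iff.mpr (hN.ge.trans (hmono (Nat.le_add_right N n)))]
  exact le_top

end Noetherian

section DimensionFiltration

variable {N : ℕ} (hN : Module.supportDim R M < N)

include hN in
theorem exists_eq_natCast_of_mem_submoduleDims {d : WithBot ℕ∞} (hd : d ∈ submoduleDims R M) :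
    ∃ a < N, d = a := by
  obtain ⟨L, hL, rfl⟩ := hd
  have : Nontrivial L := Submodule.nontrivial_iff_ne_bot.mpr hL
  exact exists_supportDim_eq_natCast
    ((Module.supportDim_le_of_injective L.subtype L.subtype_injective).trans_lt hN)

include hN in
theorem IsDimensionFiltration.exists_succ_eq_dimSub {l : ℕ} {D : Fin (l + 1) → Submodule R M}
    (hD : IsDimensionFiltration D) : ∃ a : Fin l → ℕ, StrictMono a ∧
      (∀ k : ℕ, (k : WithBot ℕ∞) ∈ submoduleDims R M ↔ ∃ i, a i = k) ∧
      ∀ i, D i.succ = dimSub R M (a i + 1) := by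
  obtain ⟨d, hd, hrange, -, hDs⟩ := hD
  choose a _ ha using fun i =>
    exists_eq_natCast_of_mem_submoduleDims hN (hrange.le (Set.mem_range_self i))
  refine ⟨a, fun i j hij => ?_, fun k => ?_, fun i => ?_⟩
  · have := hd hij
    rw [ha, ha] at this
    exact_mod_cast this
  · simp only [← hrange, Set.mem_range, ha, Nat.cast_inj]
  · have hgreatest := hDs i
    rw [ha] at hgreatest
    exact le_antisymm (le_dimSub_succ_iff.mpr hgreatest.1)
      (hgreatest.2 (le_dimSub_succ_iff.mp le_rfl))

include hN in
theorem IsDimensionFiltration.exists_eq_dimSub {l : ℕ} {D : Fin (l + 1) → Submodule R M}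
    (hD : IsDimensionFiltration D) : ∃ a : Fin l → ℕ,
      (∀ k : ℕ, (k : WithBot ℕ∞) ∈ submoduleDims R M ↔ ∃ i, a i = k) ∧
      ∀ i, D i.succ = dimSub R M (a i + 1) ∧ D i.castSucc = dimSub R M (a i) := by
  obtain ⟨a, hmono, hdims, hsucc⟩ := hD.exists_succ_eq_dimSub hN
  refine ⟨a, hdims, fun i => ⟨hsucc i, ?_⟩⟩
  obtain ⟨l, rfl⟩ : ∃ k, l = k + 1 := ⟨l - 1, by have := i.2; omega⟩
  induction i using Fin.cases with
  | zero =>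
    rw [Fin.castSucc_zero, hD.choose_spec.2.2.1, ← dimSub_zero]
    refine (dimSub_eq_of_forall_notMem_submoduleDims (Nat.zero_le _) fun k _ hk hmem => ?_).symm
    obtain ⟨i, rfl⟩ := (hdims k).mp hmem
    exact (hmono.lt_iff_lt.mp hk).not_ge (Fin.zero_le i)
  | succ j =>
    rw [← Fin.succ_castSucc, hsucc]
    refine (dimSub_eq_of_forall_notMem_submoduleDims (hmono Fin.castSucc_lt_succ)
      fun k hk hk' hmem => ?_).symm
    obtain ⟨i, rfl⟩ := (hdims k).mp hmem
    exact (Fin.castSucc_lt_iff_succ_le.mp (hmono.lt_iff_lt.mp hk)).not_gt (hmono.lt_iff_lt.mp hk')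

include hN in
theorem exists_isDimensionFiltration :
    ∃ (l : ℕ) (D : Fin (l + 1) → Submodule R M), IsDimensionFiltration D := by
  classical
  let S : Finset ℕ := {a ∈ Finset.range N | (a : WithBot ℕ∞) ∈ submoduleDims R M}
  let e := S.orderEmbOfFin rfl
  refine ⟨S.card, Fin.cons ⊥ fun i => dimSub R M (e i + 1), fun i => ((e i : ℕ) : WithBot ℕ∞),
    fun i j hij => ?_, ?_, by simp, fun i => ⟨?_, fun L hL => ?_⟩⟩
  · have := e.strictMono hij
    change ((e i : ℕ) : WithBot ℕ∞) < ((e j : ℕ) : WithBot ℕ∞)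
    exact_mod_cast this
  · ext d
    constructor
    · rintro ⟨i, rfl⟩
      exact (Finset.mem_filter.mp (S.orderEmbOfFin_mem rfl i)).2
    · intro hd
      obtain ⟨a, haN, rfl⟩ := exists_eq_natCast_of_mem_submoduleDims hN hd
      have haS : a ∈ Set.range e := by
        rw [Finset.range_orderEmbOfFin]
        exact Finset.mem_filter.mpr ⟨Finset.mem_range.mpr haN, hd⟩
      obtain ⟨i, rfl⟩ := haS
      exact ⟨i, rfl⟩
  · rw [Fin.cons_succ]
    exact le_dimSub_succ_iff.mp le_rfl
  · rw [Fin.cons_succ]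
    exact le_dimSub_succ_iff.mpr hL

include hN in
theorem isSequentiallyCM_iff :
    IsSequentiallyCM R M ↔ ∀ n, IsCohenMacaulayModule R (DimQuot R M n) := by
  constructor
  · rintro ⟨l, D, hD, hCM⟩ n
    obtain ⟨a, hdims, ha⟩ := hD.exists_eq_dimSub hN
    by_cases hn : (n : WithBot ℕ∞) ∈ submoduleDims R M
    · obtain ⟨i, rfl⟩ := (hdims n).mp hn
      have := hCM i
      rwa [(ha i).1, (ha i).2] at this
    · have heq : dimSub R M (n + 1) = dimSub R M n :=
        dimSub_eq_of_forall_notMem_submoduleDims n.le_succ fun k hk hk' =>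
          le_antisymm (Nat.lt_succ_iff.mp hk') hk ▸ hn
      have : Subsingleton (DimQuot R M n) :=
        Submodule.Quotient.subsingleton_iff.mpr (Submodule.submoduleOf_eq_top.mpr heq.le)
      exact .of_subsingleton R _
  · intro h
    obtain ⟨l, D, hD⟩ := exists_isDimensionFiltration hN
    obtain ⟨a, -, ha⟩ := hD.exists_eq_dimSub hN
    refine ⟨l, D, hD, fun i => ?_⟩
    rw [(ha i).1, (ha i).2]
    exact h (a i)

end DimensionFiltration

end DimSub

/-! ### Localization of the dimension filtration -/

section Subquotient

variable {R : Type*} [CommRing R] (S : Submonoid R)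
  {A : Type*} [CommRing A] [Algebra R A] [IsLocalization S A]
  {M : Type*} [AddCommGroup M] [Module R M] {M' : Type*} [AddCommGroup M'] [Module R M']
  (f : M →ₗ[R] M') [IsLocalizedModule S f] [Module A M'] [IsScalarTower R A M']
  (E E' : Submodule R M)

theorem coe_mk'_toLocalized' (y : E') (s : S) :
    ((IsLocalizedModule.mk' (E'.toLocalized' A S f) y s : E'.localized' A S f) : M') =
      IsLocalizedModule.mk' f (y : M) s := by
  symm
  rw [IsLocalizedModule.mk'_eq_iff]
  exact (congrArg Subtype.val (IsLocalizedModule.mk'_cancel' (E'.toLocalized' A S f) y s)).symm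

theorem localized'_submoduleOf :
    (E.submoduleOf E').localized' A S (E'.toLocalized' A S f) =
      (E.localized' A S f).submoduleOf (E'.localized' A S f) := by
  ext ⟨x, hx⟩
  constructor
  · rintro ⟨y, hy, s, hs⟩
    exact ⟨y, hy, s, by rw [← coe_mk'_toLocalized' S (A := A), hs]; rfl⟩
  · rintro ⟨y, hy, s, hs⟩
    obtain ⟨z, hz, t, ht⟩ := hx
    have hs' : IsLocalizedModule.mk' f y s = x := hs
    obtain ⟨u, hu⟩ := (IsLocalizedModule.mk'_eq_mk'_iff f y z s t).mp (hs'.trans ht.symm)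
    have hmem : u • t • y ∈ E' := hu ▸ E'.smul_mem u.1 (E'.smul_mem s.1 hz)
    refine ⟨⟨u • t • y, hmem⟩, E.smul_mem u.1 (E.smul_mem t.1 hy), u * (t * s), Subtype.ext ?_⟩
    rw [coe_mk'_toLocalized', IsLocalizedModule.mk'_cancel_left,
      IsLocalizedModule.mk'_cancel_left, hs']

theorem exists_isLocalizedModule_subquotient :
    ∃ g : (E' ⧸ E.submoduleOf E') →ₗ[R]
      (E'.localized' A S f ⧸ (E.localized' A S f).submoduleOf (E'.localized' A S f)),
      IsLocalizedModule S g := by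
  let e := (Submodule.quotEquivOfEq _ _
    (localized'_submoduleOf S (A := A) f E E')).restrictScalars R
  exact ⟨e.toLinearMap ∘ₗ (E.submoduleOf E').toLocalizedQuotient' A S (E'.toLocalized' A S f),
    IsLocalizedModule.of_linearEquiv S _ e⟩

end Subquotient

section LocalizeDimSub

variable {R : Type*} [CommRing R] [IsNoetherianRing R] (q : PrimeSpectrum R)
  {A : Type*} [CommRing A] [Algebra R A] [IsLocalization.AtPrime A q.asIdeal]
  {M : Type*} [AddCommGroup M] [Module R M] [Module.Finite R M]
  {M' : Type*} [AddCommGroup M'] [Module R M']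
  (f : M →ₗ[R] M') [IsLocalizedModule q.asIdeal.primeCompl f] [Module A M'] [IsScalarTower R A M']
  {c : ℕ} (hc : ∀ k, ∀ p : PrimeSpectrum R, p.asIdeal ∈ associatedPrimes R (DimQuot R M k) →
    p ≤ q → relHeight p q + c = k)

include hc in
theorem localized'_dimSub_eq_bot : (dimSub R M c).localized' A q.asIdeal.primeCompl f = ⊥ := by
  by_contra hbot
  have hq : q ∈ Module.support R (dimSub R M c) :=
    (nontrivial_iff_mem_support_of_isLocalizedModule q
      ((dimSub R M c).toLocalized' A q.asIdeal.primeCompl f)).mp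
      (Submodule.nontrivial_iff_ne_bot.mpr hbot)
  obtain ⟨p, hp, hpq⟩ := exists_associatedPrime_le_of_mem_support hq
  obtain ⟨k, hkc, hk⟩ := exists_mem_associatedPrimes_subquotient dimSub_mono dimSub_zero hp
  have hck := hc k p hk hpq ▸ le_add_self (a := (c : ℕ∞))
  exact hkc.not_ge (by exact_mod_cast hck)

variable {N : ℕ} (hN : Module.supportDim R M < N)

include hN hc in
theorem localized'_dimSub_add (n : ℕ) :
    (dimSub R M (c + n)).localized' A q.asIdeal.primeCompl f = dimSub A M' n := by
  have : IsNoetherianRing A := IsLocalization.isNoetherianRing q.asIdeal.primeCompl A inferInstance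
  have : Module.Finite A M' := Module.Finite.of_isLocalizedModule q.asIdeal.primeCompl f
  let F (n : ℕ) : Submodule A M' := (dimSub R M (c + n)).localized' A q.asIdeal.primeCompl f
  have hmono : Monotone F := fun a b hab =>
    (Submodule.localized'gi A q.asIdeal.primeCompl f).gc.monotone_l (dimSub_mono (by omega))
  have hbot : F 0 = ⊥ := localized'_dimSub_eq_bot q f hc
  have htop : F N = ⊤ := by
    have : dimSub R M (c + N) = ⊤ :=
      top_le_iff.mp (dimSub_eq_top_iff.mpr hN ▸ dimSub_mono (Nat.le_add_left N c))
    simp only [F, this, Submodule.localized'_top]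
  have hcoheight (n : ℕ) (P : PrimeSpectrum A) (hP : P.asIdeal ∈ associatedPrimes A
      (F (n + 1) ⧸ (F n).submoduleOf (F (n + 1)))) : Order.coheight P = n := by
    obtain ⟨g, hg⟩ := exists_isLocalizedModule_subquotient (A := A) q.asIdeal.primeCompl f
      (dimSub R M (c + n)) (dimSub R M (c + n + 1))
    have hP' := hc (c + n) _ ((mem_associatedPrimes_iff_comap q g P).mp hP)
      (comap_le_of_isLocalization_atPrime q P)
    rw [coheight_eq_relHeight_comap q]
    rw [add_comm, Nat.cast_add] at hP'
    exact ENat.add_right_injective_of_ne_top (ENat.natCast_ne_top c) hP'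
  exact le_antisymm (le_dimSub_of_coheight_eq hmono hcoheight hbot n)
    (dimSub_le_of_coheight_eq hmono hcoheight htop n)

include f hN hc in
theorem isSequentiallyCM_atPrime_iff : IsSequentiallyCM A M' ↔
    ∀ k, q ∈ Module.support R (DimQuot R M k) → ∃ n, IsCMAt (DimQuot R M k) q n := by
  have hN' : Module.supportDim A M' < N := by
    have htop : dimSub R M (c + N) = ⊤ :=
      top_le_iff.mp (dimSub_eq_top_iff.mpr hN ▸ dimSub_mono (Nat.le_add_left N c))
    rw [← dimSub_eq_top_iff, ← localized'_dimSub_add q f hc hN, htop, Submodule.localized'_top]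
  have hquot (n : ℕ) : IsCohenMacaulayModule A (DimQuot A M' n) ↔
      (q ∈ Module.support R (DimQuot R M (c + n)) → ∃ m, IsCMAt (DimQuot R M (c + n)) q m) := by
    obtain ⟨g, hg⟩ := exists_isLocalizedModule_subquotient (A := A) q.asIdeal.primeCompl f
      (dimSub R M (c + n)) (dimSub R M (c + n + 1))
    have h := isCohenMacaulayModule_atPrime_iff (A := A) q g
    rwa [add_assoc c, localized'_dimSub_add q f hc hN, localized'_dimSub_add q f hc hN] at h
  rw [isSequentiallyCM_iff hN', forall_congr' hquot]
  refine ⟨fun h k hk => ?_, fun h n => h (c + n)⟩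
  obtain ⟨p, hp, hpq⟩ := exists_associatedPrime_le_of_mem_support hk
  have hck := hc k p hp hpq ▸ le_add_self (a := (c : ℕ∞))
  obtain ⟨n, rfl⟩ := Nat.exists_eq_add_of_le (by exact_mod_cast hck : c ≤ k)
  exact h n hk

end LocalizeDimSub

/-! ### Primes of a `ℤ`-graded ring -/

section GradedPrimes

open DirectSum

theorem exists_forall_notMem_of_finite {s : Set ℤ} (hs : s.Finite) :
    ∃ (b : ℤ) (k : ℕ), ∀ i, i < b ∨ b + k < i → i ∉ s := by
  obtain ⟨a, ha⟩ := hs.bddBelow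
  obtain ⟨b, hb⟩ := hs.bddAbove
  refine ⟨a, (b - a).toNat, fun i hi his => ?_⟩
  have := ha his
  have := hb his
  omega

theorem eq_of_lt_of_le_of_mem_minimalPrimes {R : Type*} [CommRing R] [IsNoetherianRing R]
    {I r q : Ideal R} [hI : I.IsPrime] [hr : r.IsPrime] {f : R} (hIr : I < r) (hrq : r ≤ q)
    (hq : q ∈ (I ⊔ Ideal.span {f}).minimalPrimes) : r = q := by
  have hprime {J : Ideal R} (hJ : J.IsPrime) (hIJ : I ≤ J) :
      (J.map (Ideal.Quotient.mk I)).IsPrime :=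
    Ideal.map_isPrime_of_surjective Ideal.Quotient.mk_surjective (by rwa [Ideal.mk_ker])
  have hlt {J K : Ideal R} (hIJ : I ≤ J) (hJK : J < K) :
      J.map (Ideal.Quotient.mk I) < K.map (Ideal.Quotient.mk I) := by
    refine lt_of_le_of_ne (Ideal.map_mono hJK.le) fun heq => hJK.ne ?_
    rwa [Ideal.map_eq_iff_sup_ker_eq_of_surjective _ Ideal.Quotient.mk_surjective, Ideal.mk_ker,
      sup_eq_left.mpr hIJ, sup_eq_left.mpr (hIJ.trans hJK.le)] at heq
  by_contra hne
  have := hprime hI le_rfl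
  have := hprime hr hIr.le
  have := hprime hq.1.1 (hIr.le.trans hrq)
  have : (2 : ℕ∞) ≤ 1 :=
    calc (2 : ℕ∞) = 0 + 1 + 1 := by norm_num
      _ ≤ (I.map (Ideal.Quotient.mk I)).height + 1 + 1 := by gcongr; exact zero_le
      _ ≤ (r.map (Ideal.Quotient.mk I)).height + 1 := by
        gcongr
        exact Ideal.height_add_one_le_of_lt_of_isPrime (hlt le_rfl hIr)
      _ ≤ (q.map (Ideal.Quotient.mk I)).height :=
        Ideal.height_add_one_le_of_lt_of_isPrime (hlt hIr.le (lt_of_le_of_ne hrq hne))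
      _ ≤ 1 := Ideal.map_height_le_one_of_mem_minimalPrimes hq
  exact absurd this (by decide)

variable {R : Type*} [CommRing R] (𝒜 : ℤ → AddSubgroup R) [GradedRing 𝒜]

/-- The prime `q*` generated by the homogeneous elements of a prime `q`. -/
def homCore (q : PrimeSpectrum R) : PrimeSpectrum R :=
  ⟨(q.asIdeal.homogeneousCore 𝒜).toIdeal, q.2.homogeneousCore⟩

theorem homCore_le (q : PrimeSpectrum R) : homCore 𝒜 q ≤ q :=
  Ideal.toIdeal_homogeneousCore_le 𝒜 q.asIdeal

theorem homCore_isHomogeneous (q : PrimeSpectrum R) : (homCore 𝒜 q).asIdeal.IsHomogeneous 𝒜 :=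
  (q.asIdeal.homogeneousCore 𝒜).isHomogeneous

theorem homCore_mono : Monotone (homCore 𝒜) := fun _ _ h => Ideal.homogeneousCore_mono 𝒜 h

/-- Modulo `I`, all components of `g` live in the degrees from `b` to `b + k`. -/
def HasComponentsIn (I : Ideal R) (b : ℤ) (k : ℕ) (g : R) : Prop :=
  ∀ i, i < b ∨ b + k < i → (decompose 𝒜 g i : R) ∈ I

theorem exists_hasComponentsIn (I : Ideal R) (g : R) : ∃ b k, HasComponentsIn 𝒜 I b k g := by
  classical
  obtain ⟨b, k, h⟩ := exists_forall_notMem_of_finite (decompose 𝒜 g).support.finite_toSet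
  refine ⟨b, k, fun i hi => ?_⟩
  rw [DFinsupp.notMem_support_iff.mp (h i hi)]
  exact zero_mem I

variable {𝒜}

theorem le_homCore {p q : PrimeSpectrum R} (hp : p.asIdeal.IsHomogeneous 𝒜) (hpq : p ≤ q) :
    p ≤ homCore 𝒜 q := by
  rw [← PrimeSpectrum.asIdeal_le_asIdeal, ← hp.toIdeal_homogeneousCore_eq_self]
  exact homCore_mono 𝒜 hpq

theorem homCore_eq_of_isHomogeneous {q : PrimeSpectrum R} (hq : q.asIdeal.IsHomogeneous 𝒜) :
    homCore 𝒜 q = q :=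
  le_antisymm (homCore_le 𝒜 q) (le_homCore hq le_rfl)

theorem mem_homCore_of_mem {q : PrimeSpectrum R} {i : ℤ} {x : R} (hx : x ∈ 𝒜 i)
    (hxq : x ∈ q.asIdeal) : x ∈ (homCore 𝒜 q).asIdeal :=
  Ideal.mem_homogeneousCore_of_homogeneous_of_mem ⟨i, hx⟩ hxq

theorem decompose_sub_decompose (x : R) (i j : ℤ) :
    (decompose 𝒜 (x - decompose 𝒜 x j) i : R) = if i = j then 0 else ↑(decompose 𝒜 x i) := by
  rw [decompose_sub, DirectSum.sub_apply, AddSubgroup.coe_sub]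
  split_ifs with h
  · rw [h, decompose_of_mem_same 𝒜 (decompose 𝒜 x j).2, sub_self]
  · rw [decompose_of_mem_ne 𝒜 (decompose 𝒜 x j).2 (Ne.symm h), sub_zero]

theorem sub_decompose_mem {I : Ideal R} (hI : I.IsHomogeneous 𝒜) {x : R} {j : ℤ}
    (h : ∀ i, i ≠ j → (decompose 𝒜 x i : R) ∈ I) : x - decompose 𝒜 x j ∈ I := by
  refine hI.mem_iff.mpr fun i => ?_
  rw [decompose_sub_decompose]
  split_ifs with hi
  · exact zero_mem I
  · exact h i hi

theorem mem_homCore_of_forall_ne {q : PrimeSpectrum R} {x : R} {j : ℤ} (hxq : x ∈ q.asIdeal)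
    (h : ∀ i, i ≠ j → (decompose 𝒜 x i : R) ∈ (homCore 𝒜 q).asIdeal) :
    x ∈ (homCore 𝒜 q).asIdeal := by
  have hsub := sub_decompose_mem (homCore_isHomogeneous 𝒜 q) h
  have hj : (decompose 𝒜 x j : R) ∈ q.asIdeal := by
    simpa only [sub_sub_cancel] using q.asIdeal.sub_mem hxq (homCore_le 𝒜 q hsub)
  simpa only [sub_add_cancel] using
    add_mem hsub (mem_homCore_of_mem (decompose 𝒜 x j).2 hj)

theorem isHomogeneous_of_forall_leading_mem {I : Ideal R}
    (h : ∀ a ∈ I, ∀ s, (∀ j, s < j → (decompose 𝒜 a j : R) = 0) → (decompose 𝒜 a s : R) ∈ I) :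
    I.IsHomogeneous 𝒜 := by
  have hwidth : ∀ (k : ℕ) (b : ℤ), ∀ a ∈ I, HasComponentsIn 𝒜 ⊥ b k a →
      ∀ i, (decompose 𝒜 a i : R) ∈ I := by
    intro k b
    induction k with
    | zero =>
      intro a ha hab i
      by_cases hi : i = b
      · exact hi ▸ h a ha b fun j hj => hab j (by omega)
      · rw [show (decompose 𝒜 a i : R) = 0 from hab i (by omega)]
        exact zero_mem I
    | succ k ih =>
      intro a ha hab i
      have hlead := h a ha (b + (k + 1 : ℕ)) fun j hj => hab j (Or.inr hj)
      have hsub := ih _ (I.sub_mem ha hlead) (fun j hj => by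
        rw [decompose_sub_decompose]
        split_ifs with hj'
        · exact zero_mem _
        · exact hab j (by omega)) i
      rw [decompose_sub_decompose] at hsub
      split_ifs at hsub with hi
      · exact hi ▸ hlead
      · exact hsub
  intro i a ha
  obtain ⟨b, k, hab⟩ := exists_hasComponentsIn 𝒜 ⊥ a
  exact hwidth k b a ha hab i

theorem HasComponentsIn.mul_sub_mul {I : Ideal R} {a b : ℤ} {l k : ℕ} {f g : R}
    (hf : HasComponentsIn 𝒜 I a l f) (hg : HasComponentsIn 𝒜 I b (k + 1) g) (hlk : l ≤ k + 1) :
    HasComponentsIn 𝒜 I (a + l + b) k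
      (decompose 𝒜 f (a + l) * g - f * decompose 𝒜 g (b + (k + 1 : ℕ))) := by
  intro i hi
  have hcg : (decompose 𝒜 (decompose 𝒜 f (a + l) * g) i : R) =
      decompose 𝒜 f (a + l) * decompose 𝒜 g (i - (a + l)) := by
    rw [← coe_decompose_mul_add_of_left_mem 𝒜 (decompose 𝒜 f (a + l)).2, add_sub_cancel]
  have hfe : (decompose 𝒜 (f * decompose 𝒜 g (b + (k + 1 : ℕ))) i : R) =
      decompose 𝒜 f (i - (b + (k + 1 : ℕ))) * decompose 𝒜 g (b + (k + 1 : ℕ)) := by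
    rw [← coe_decompose_mul_add_of_right_mem 𝒜 (decompose 𝒜 g (b + (k + 1 : ℕ))).2,
      sub_add_cancel]
  rw [decompose_sub, DirectSum.sub_apply, AddSubgroup.coe_sub, hcg, hfe]
  by_cases hi' : i = a + l + b + (k + 1 : ℕ)
  · have hi₁ : i - (a + l) = b + (k + 1 : ℕ) := by omega
    have hi₂ : i - (b + (k + 1 : ℕ)) = a + l := by omega
    rw [hi₁, hi₂, sub_self]
    exact zero_mem I
  · exact I.sub_mem (I.mul_mem_left _ (hg _ (by omega))) (I.mul_mem_right _ (hf _ (by omega)))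

/-- Pseudo-division by an element `f` of an ideal `J` whose components occupy as few degrees as
possible among the elements of `J` outside of `I`. -/
theorem HasComponentsIn.exists_pow_mul_mem {I J : Ideal R} {a : ℤ} {l : ℕ} {f : R} (hfJ : f ∈ J)
    (hf : HasComponentsIn 𝒜 I a l f) (hl : 0 < l)
    (hmin : ∀ k < l, ∀ g ∈ J, ∀ b, HasComponentsIn 𝒜 I b k g → g ∈ I) {k : ℕ} {b : ℤ} {g : R}
    (hgJ : g ∈ J) (hg : HasComponentsIn 𝒜 I b k g) :
    ∃ n, (decompose 𝒜 f (a + l) : R) ^ n * g ∈ I ⊔ Ideal.span {f} := by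
  induction k generalizing g b with
  | zero => exact ⟨0, Ideal.mem_sup_left (by simpa using hmin 0 hl g hgJ b hg)⟩
  | succ k ih =>
    by_cases hkl : k + 1 < l
    · exact ⟨0, Ideal.mem_sup_left (by simpa using hmin _ hkl g hgJ b hg)⟩
    set c : R := (decompose 𝒜 f (a + l) : R)
    set e : R := (decompose 𝒜 g (b + (k + 1 : ℕ)) : R)
    obtain ⟨n, hn⟩ := ih (J.sub_mem (J.mul_mem_left c hgJ) (J.mul_mem_right e hfJ))
      (hf.mul_sub_mul hg (not_lt.mp hkl))
    have hdiv : c ^ (n + 1) * g = c ^ n * (c * g - f * e) + (c ^ n * e) * f := by ring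
    refine ⟨n + 1, hdiv ▸ add_mem hn (Ideal.mem_sup_right ?_)⟩
    exact Ideal.mul_mem_left _ _ (Ideal.mem_span_singleton_self f)

theorem exists_hasComponentsIn_minimal {q : PrimeSpectrum R} (hq : homCore 𝒜 q ≠ q) :
    ∃ f ∈ q.asIdeal, ∃ a l, HasComponentsIn 𝒜 (homCore 𝒜 q).asIdeal a l f ∧ 0 < l ∧
      (decompose 𝒜 f (a + l) : R) ∉ q.asIdeal ∧
      ∀ k < l, ∀ g ∈ q.asIdeal, ∀ b,
        HasComponentsIn 𝒜 (homCore 𝒜 q).asIdeal b k g → g ∈ (homCore 𝒜 q).asIdeal := by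
  classical
  set I := (homCore 𝒜 q).asIdeal
  have hex : ∃ l, ∃ f ∈ q.asIdeal, f ∉ I ∧ ∃ a, HasComponentsIn 𝒜 I a l f := by
    have hlt : homCore 𝒜 q < q := lt_of_le_of_ne (homCore_le 𝒜 q) hq
    obtain ⟨f, hfq, hfI⟩ := SetLike.exists_of_lt (show I < q.asIdeal from hlt)
    obtain ⟨a, l, hf⟩ := exists_hasComponentsIn 𝒜 I f
    exact ⟨l, f, hfq, hfI, a, hf⟩
  obtain ⟨f, hfq, hfI, a, hf⟩ := Nat.find_spec hex
  have hmin : ∀ k < Nat.find hex, ∀ g ∈ q.asIdeal, ∀ b, HasComponentsIn 𝒜 I b k g → g ∈ I :=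
    fun k hk g hgq b hg => by_contra fun hgI => Nat.find_min hex hk ⟨g, hgq, hgI, b, hg⟩
  set l := Nat.find hex
  have hl : 0 < l := Nat.pos_of_ne_zero fun hl =>
    hfI (mem_homCore_of_forall_ne (j := a) hfq fun i hi => hf i (by omega))
  refine ⟨f, hfq, a, l, hf, hl, fun hlead => hfI ?_, hmin⟩
  refine hmin (l - 1) (by omega) f hfq a fun i hi => ?_
  by_cases hi' : i = a + l
  · exact hi' ▸ mem_homCore_of_mem (decompose 𝒜 f (a + l)).2 hlead
  · exact hf i (by omega)

variable [IsNoetherianRing R]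

theorem eq_of_homCore_lt {r q : PrimeSpectrum R} (h : homCore 𝒜 q < r) (hrq : r ≤ q) :
    r = q := by
  obtain ⟨f, hfq, a, l, hf, hl, hlead, hmin⟩ :=
    exists_hasComponentsIn_minimal (h.trans_le hrq).ne
  refine PrimeSpectrum.ext (eq_of_lt_of_le_of_mem_minimalPrimes (I := (homCore 𝒜 q).asIdeal)
    (f := f) h hrq ⟨⟨q.2, sup_le (homCore_le 𝒜 q) ?_⟩, ?_⟩)
  · exact (Ideal.span_singleton_le_iff_mem _).mpr hfq
  · rintro J ⟨hJ, hle⟩ hJq g hgq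
    obtain ⟨b, k, hg⟩ := exists_hasComponentsIn 𝒜 (homCore 𝒜 q).asIdeal g
    obtain ⟨n, hn⟩ := hf.exists_pow_mul_mem hfq hl hmin hgq hg
    exact (hJ.mem_or_mem (hle hn)).resolve_left
      fun hpow => hlead (hJq (hJ.mem_of_pow_mem n hpow))

theorem relHeight_le_relHeight_homCore_add_one {p q : PrimeSpectrum R}
    (hp : p.asIdeal.IsHomogeneous 𝒜) :
    relHeight p q ≤ relHeight p (homCore 𝒜 q) + 1 := by
  have hseries : ∀ n, ∀ s : LTSeries (PrimeSpectrum R), s.length = n → p ≤ s.head →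
      (n : ℕ∞) ≤ relHeight p (homCore 𝒜 s.last) + 1 := by
    intro n
    induction n with
    | zero => intro s _ _; simp
    | succ n ih =>
      intro s hs hps
      have hne : s.length ≠ 0 := by omega
      have hlt : s.eraseLast.last < s.last := s.eraseLast_last_rel_last hne
      have hlen : s.eraseLast.length = n := by simp [hs]
      have hhead : p ≤ s.eraseLast.head := by simpa using hps
      have hple : p ≤ s.eraseLast.last := hhead.trans (LTSeries.monotone _ (Fin.zero_le _))
      push_cast
      gcongr
      by_cases hr : homCore 𝒜 s.eraseLast.last = s.eraseLast.last
      · rw [← hlen]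
        exact length_le_relHeight hhead (le_homCore (hr ▸ homCore_isHomogeneous 𝒜 _) hlt.le)
      · refine (ih s.eraseLast hlen hhead).trans
          (relHeight_add_one_le_of_lt_right (le_homCore hp hple) ?_)
        refine lt_of_le_of_ne (homCore_mono 𝒜 hlt.le) fun heq => hlt.ne ?_
        exact eq_of_homCore_lt (heq ▸ lt_of_le_of_ne (homCore_le 𝒜 _) hr) hlt.le
  refine relHeight_le fun s h₁ h₂ => (hseries _ s rfl h₁).trans ?_
  gcongr
  exact relHeight_mono le_rfl (homCore_mono 𝒜 h₂)

theorem relHeight_eq_relHeight_homCore_add_one {p q : PrimeSpectrum R}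
    (hp : p.asIdeal.IsHomogeneous 𝒜) (hpq : p ≤ q) (hq : homCore 𝒜 q ≠ q) :
    relHeight p q = relHeight p (homCore 𝒜 q) + 1 :=
  le_antisymm (relHeight_le_relHeight_homCore_add_one hp)
    (relHeight_add_one_le_of_lt_right (le_homCore hp hpq) (lt_of_le_of_ne (homCore_le 𝒜 q) hq))

omit [IsNoetherianRing R]

theorem exists_degree_ne_zero_notMem_homCore {q : PrimeSpectrum R} (hq : homCore 𝒜 q ≠ q) :
    ∃ e ≠ (0 : ℤ), ∃ t ∈ 𝒜 e, t ∉ (homCore 𝒜 q).asIdeal := by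
  by_contra! hcon
  exact hq (le_antisymm (homCore_le 𝒜 q) fun x hx =>
    mem_homCore_of_forall_ne (j := 0) hx fun i hi => hcon i hi _ (decompose 𝒜 x i).2)

theorem exists_homogeneous_notMem_of_not_le {I J : Ideal R} (hI : I.IsHomogeneous 𝒜)
    (h : ¬ I ≤ J) : ∃ i, ∃ x ∈ 𝒜 i, x ∈ I ∧ x ∉ J := by
  classical
  by_contra! hcon
  refine h fun x hx => ?_
  rw [← sum_support_decompose 𝒜 x]
  exact J.sum_mem fun i _ => hcon i _ (decompose 𝒜 x i).2 (hI i hx)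

theorem exists_mul_add_mul_eq {e : ℤ} (he : e ≠ 0) (d d' : ℤ) :
    ∃ A B D : ℕ, A ≠ 0 ∧ (A : ℤ) * d + B * e = A * d' + D * e := by
  have hd : ((d' - d).toNat : ℤ) - (d - d').toNat = d' - d := by omega
  rcases lt_or_gt_of_ne he with h | h
  · refine ⟨e.natAbs, (d - d').toNat, (d' - d).toNat, by omega, ?_⟩
    rw [Int.ofNat_natAbs_of_nonpos h.le]
    linear_combination -e * hd
  · refine ⟨e.natAbs, (d' - d).toNat, (d - d').toNat, by omega, ?_⟩
    rw [Int.natAbs_of_nonneg h.le]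
    linear_combination e * hd

theorem pow_mul_pow_mem_graded {d e : ℤ} {x t : R} (hx : x ∈ 𝒜 d) (ht : t ∈ 𝒜 e) (A B : ℕ) :
    x ^ A * t ^ B ∈ 𝒜 (A * d + B * e) := by
  simpa only [nsmul_eq_mul] using
    SetLike.GradedMul.mul_mem (SetLike.pow_mem_graded A hx) (SetLike.pow_mem_graded B ht)

theorem pow_mul_pow_add_pow_mul_pow_notMem {p : Ideal R} [hp : p.IsPrime] {x y t : R} {A : ℕ}
    (hA : A ≠ 0) (B D : ℕ) (hx : x ∈ p) (hy : y ∉ p) (ht : t ∉ p) :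
    x ^ A * t ^ B + y ^ A * t ^ D ∉ p := by
  rw [Ideal.add_mem_iff_right p (p.mul_mem_right _ (p.pow_mem_of_mem hx A (Nat.pos_of_ne_zero hA)))]
  exact fun h => (hp.mem_or_mem h).elim (fun h => hy (hp.mem_of_pow_mem A h))
    fun h => ht (hp.mem_of_pow_mem D h)

/-- The powers of `t` serve to add homogeneous elements of different degrees. -/
theorem exists_homogeneous_forall_notMem_of_antichain {I : Ideal R} (hI : I.IsHomogeneous 𝒜)
    {e : ℤ} {t : R} (he : e ≠ 0) (ht : t ∈ 𝒜 e) (htI : t ∉ I) (T : Finset (Ideal R))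
    (hT : ∀ p ∈ T, p.IsPrime ∧ p.IsHomogeneous 𝒜 ∧ p < I)
    (hanti : IsAntichain (· ≤ ·) (T : Set (Ideal R))) :
    ∃ d, ∃ x ∈ 𝒜 d, x ∈ I ∧ ∀ p ∈ T, x ∉ p := by
  classical
  induction T using Finset.induction_on with
  | empty => exact ⟨0, 0, zero_mem _, zero_mem _, by simp⟩
  | insert p T hpT ih =>
    obtain ⟨d, x, hxd, hxI, hxT⟩ := ih (fun p' hp' => hT p' (Finset.mem_insert_of_mem hp'))
      (hanti.subset (Finset.coe_subset.mpr (Finset.subset_insert p T)))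
    by_cases hxp : x ∈ p
    swap
    · exact ⟨d, x, hxd, hxI, (Finset.forall_mem_insert _ _ _).mpr ⟨hxp, hxT⟩⟩
    obtain ⟨hp, -, hpI⟩ := hT p (Finset.mem_insert_self p T)
    have hinf : ¬ I ⊓ T.inf id ≤ p := by
      rw [hp.inf_le, hp.inf_le', not_or]
      refine ⟨hpI.not_ge, ?_⟩
      rintro ⟨p', hp', hle⟩
      refine hanti (Finset.mem_insert_of_mem hp') (Finset.mem_insert_self p T) ?_ hle
      rintro rfl
      exact hpT hp'
    have hhom : (I ⊓ T.inf id).IsHomogeneous 𝒜 := by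
      rw [Finset.inf_id_eq_sInf]
      exact hI.inf (Ideal.IsHomogeneous.sInf fun p' hp' =>
        (hT p' (Finset.mem_insert_of_mem hp')).2.1)
    obtain ⟨d', y, hyd, ⟨hyI, hyT⟩, hyp⟩ := exists_homogeneous_notMem_of_not_le hhom hinf
    obtain ⟨A, B, D, hA, hdeg⟩ := exists_mul_add_mul_eq he d d'
    have hmemI {z : R} (hz : z ∈ I) (n : ℕ) : z ^ A * t ^ n ∈ I :=
      I.mul_mem_right _ (I.pow_mem_of_mem hz A (Nat.pos_of_ne_zero hA))
    refine ⟨_, _, add_mem (pow_mul_pow_mem_graded hxd ht A B)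
      (hdeg ▸ pow_mul_pow_mem_graded hyd ht A D), add_mem (hmemI hxI B) (hmemI hyI D),
      fun p' hp' => ?_⟩
    obtain ⟨hp'prime, -, hp'I⟩ := hT p' hp'
    have htp' : t ∉ p' := fun h => htI (hp'I.le h)
    rcases Finset.mem_insert.mp hp' with rfl | hp'T
    · exact pow_mul_pow_add_pow_mul_pow_notMem hA B D hxp hyp htp'
    · rw [add_comm]
      exact pow_mul_pow_add_pow_mul_pow_notMem hA D B (Finset.inf_le (f := id) hp'T hyT)
        (hxT p' hp'T) htp'

theorem exists_homogeneous_forall_notMem {I : Ideal R} (hI : I.IsHomogeneous 𝒜)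
    {e : ℤ} {t : R} (he : e ≠ 0) (ht : t ∈ 𝒜 e) (htI : t ∉ I) {T : Set (Ideal R)} (hfin : T.Finite)
    (hT : ∀ p ∈ T, p.IsPrime ∧ p.IsHomogeneous 𝒜 ∧ p < I) :
    ∃ d, ∃ x ∈ 𝒜 d, x ∈ I ∧ ∀ p ∈ T, x ∉ p := by
  have hfin' : {p | Maximal (· ∈ T) p}.Finite := hfin.subset fun p hp => hp.1
  obtain ⟨d, x, hxd, hxI, hx⟩ := exists_homogeneous_forall_notMem_of_antichain hI he ht htI
    hfin'.toFinset (fun p hp => hT p (hfin'.mem_toFinset.mp hp).1)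
    (by rw [hfin'.coe_toFinset]; exact setOfPred_maximal_antichain _)
  refine ⟨d, x, hxd, hxI, fun p hp hxp => ?_⟩
  obtain ⟨p', hle, hp'⟩ := hfin.exists_le_maximal hp
  exact hx p' (hfin'.mem_toFinset.mpr hp') (hle hxp)

end GradedPrimes

/-! ### Graded modules -/

section GradedModules

open DirectSum

variable {R : Type*} [CommRing R] (𝒜 : ℤ → AddSubgroup R)

/-- A grading of an `R`-module, given by the projections to its components: in this form it passes
directly to homogeneous submodules and quotients. The orthogonality of the projections is not
recorded. -/
structure ModuleGrading (M : Type*) [AddCommGroup M] [Module R M] where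
  proj : ℤ → M →+ M
  finite : ∀ x, {i | proj i x ≠ 0}.Finite
  mem_of_forall_mem : ∀ (x : M) (N : AddSubgroup M), (∀ i, proj i x ∈ N) → x ∈ N
  proj_smul : ∀ {i : ℤ} {a : R}, a ∈ 𝒜 i → ∀ (j : ℤ) (x : M),
    proj (i + j) (a • x) = a • proj j x

namespace ModuleGrading

variable {𝒜} {M : Type*} [AddCommGroup M] [Module R M]

/-- The grading given by a decomposition into subgroups. -/
def ofDecomposition (ℳ : ℤ → AddSubgroup M) [Decomposition ℳ] [SetLike.GradedSMul 𝒜 ℳ] :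
    ModuleGrading 𝒜 M where
  proj i := AddMonoidHom.mk' (fun x => (decompose ℳ x i : M)) fun x y => by
    rw [decompose_add, DirectSum.add_apply, AddSubgroup.coe_add]
  finite x := by
    classical
    refine (decompose ℳ x).support.finite_toSet.subset fun i hi => ?_
    exact DFinsupp.mem_support_iff.mpr fun h => hi (by simp [h])
  mem_of_forall_mem x N h := by
    classical
    rw [← sum_support_decompose ℳ x]
    exact N.sum_mem fun i _ => h i
  proj_smul {i a} ha j x := by
    classical
    have hmem : ∀ k, a • (decompose ℳ x k : M) ∈ ℳ (i + k) := fun k =>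
      SetLike.GradedSMul.smul_mem ha (decompose ℳ x k).2
    change (decompose ℳ (a • x) (i + j) : M) = a • (decompose ℳ x j : M)
    conv_lhs => rw [← sum_support_decompose ℳ x, Finset.smul_sum, decompose_sum]
    rw [DirectSum.sum_apply, AddSubgroup.val_finsetSum, Finset.sum_eq_single j]
    · exact decompose_of_mem_same ℳ (hmem j)
    · exact fun k _ hk => decompose_of_mem_ne ℳ (hmem k) (by omega)
    · intro hj
      rw [DFinsupp.notMem_support_iff.mp hj]
      simp

variable (G : ModuleGrading 𝒜 M)

theorem proj_eq_smul_proj {i : ℤ} {a : R} (ha : a ∈ 𝒜 i) (j : ℤ) (x : M) :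
    G.proj j (a • x) = a • G.proj (j - i) x := by
  rw [← G.proj_smul ha, add_sub_cancel]

/-- The grading induced on a homogeneous submodule. -/
def restrict (N : Submodule R M) (hN : ∀ i, ∀ x ∈ N, G.proj i x ∈ N) : ModuleGrading 𝒜 N where
  proj i := AddMonoidHom.mk' (fun x => ⟨G.proj i x, hN i x x.2⟩) fun x y =>
    Subtype.ext (by simp)
  finite x := (G.finite x).subset fun i hi h => hi (Subtype.ext h)
  mem_of_forall_mem x L h := by
    obtain ⟨y, hy, hyx⟩ := G.mem_of_forall_mem x (L.map N.subtype.toAddMonoidHom)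
      fun i => ⟨_, h i, rfl⟩
    rwa [← Subtype.ext (show (y : M) = x from hyx)]
  proj_smul ha j x := Subtype.ext (G.proj_smul ha j x)

/-- The grading induced on the quotient by a homogeneous submodule. -/
def quotient (N : Submodule R M) (hN : ∀ i, ∀ x ∈ N, G.proj i x ∈ N) :
    ModuleGrading 𝒜 (M ⧸ N) where
  proj i := QuotientAddGroup.map N.toAddSubgroup N.toAddSubgroup (G.proj i) (hN i)
  finite x := by
    obtain ⟨y, rfl⟩ := Submodule.mkQ_surjective N x
    refine (G.finite y).subset fun i hi h => hi ?_
    change Submodule.Quotient.mk (G.proj i y) = (0 : M ⧸ N)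
    rw [h, Submodule.Quotient.mk_zero]
  mem_of_forall_mem x L h := by
    obtain ⟨y, rfl⟩ := Submodule.mkQ_surjective N x
    exact G.mem_of_forall_mem y (L.comap N.mkQ.toAddMonoidHom) h
  proj_smul ha j x := by
    obtain ⟨y, rfl⟩ := Submodule.mkQ_surjective N x
    exact congrArg (Submodule.Quotient.mk (p := N)) (G.proj_smul ha j y)

/-- The grading induced on `M / xM` for a homogeneous element `x`. -/
def quotSMulTop {d : ℤ} {x : R} (hx : x ∈ 𝒜 d) : ModuleGrading 𝒜 (QuotSMulTop x M) :=
  G.quotient (x • ⊤) fun i y hy => by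
    obtain ⟨z, -, rfl⟩ := (Submodule.mem_smul_pointwise_iff_exists y x ⊤).mp hy
    rw [G.proj_eq_smul_proj hx]
    exact Submodule.smul_mem_pointwise_smul _ x ⊤ trivial

theorem smul_eq_zero_of_forall_proj {r : R} {x : M} (h : ∀ i, r • G.proj i x = 0) : r • x = 0 :=
  G.mem_of_forall_mem x (LinearMap.ker (LinearMap.lsmul R M r)).toAddSubgroup h

variable [GradedRing 𝒜]

/-- If `a` kills `x`, then the powers of the leading component of `a` kill the components of `x`,
one after the other starting with the leading one. -/
theorem leading_pow_smul_proj_eq_zero {a : R} {x : M} {s t : ℤ} (hax : a • x = 0)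
    (ha : ∀ j, s < j → (decompose 𝒜 a j : R) = 0) (hx : ∀ j, t < j → G.proj j x = 0) (m : ℕ) :
    (decompose 𝒜 a s : R) ^ (m + 1) • G.proj (t - m) x = 0 := by
  classical
  set c : R := (decompose 𝒜 a s : R)
  induction m using Nat.strong_induction_on with
  | _ m ih =>
  have hlower : ∀ j, s < j → c ^ m • G.proj (t - m - s + j) x = 0 := by
    intro j hj
    by_cases hjt : t < t - m - s + j
    · rw [hx _ hjt, smul_zero]
    obtain ⟨k, hk, hkm⟩ : ∃ k : ℕ, t - m - s + j = t - k ∧ k < m :=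
      ⟨(s + m - j).toNat, by omega, by omega⟩
    rw [hk, ← Nat.sub_add_cancel hkm, pow_add, mul_smul, ih k hkm, smul_zero]
  have hcomp : G.proj (s + (t - m)) (a • x) =
      ∑ j ∈ (decompose 𝒜 a).support, (decompose 𝒜 a j : R) • G.proj (s + (t - m) - j) x := by
    conv_lhs => rw [← sum_support_decompose 𝒜 a, Finset.sum_smul, map_sum]
    exact Finset.sum_congr rfl fun j _ => G.proj_eq_smul_proj (decompose 𝒜 a j).2 _ _
  calc c ^ (m + 1) • G.proj (t - m) x = c ^ m • G.proj (s + (t - m)) (a • x) := by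
        rw [hcomp, Finset.smul_sum, Finset.sum_eq_single s]
        · rw [add_sub_cancel_left, smul_smul, pow_succ]
        · intro j _ hjs
          rcases lt_or_gt_of_ne hjs with hj | hj
          · have hdeg : s + (t - m) - j = t - m - s + (2 * s - j) := by ring
            rw [smul_comm, hdeg, hlower _ (by omega), smul_zero]
          · rw [ha j hj, zero_smul, smul_zero]
        · intro hs
          rw [DFinsupp.notMem_support_iff.mp hs]
          simp
    _ = 0 := by rw [hax, map_zero, smul_zero]

include G in
theorem exists_leading_pow_smul_eq_zero {a : R} {x : M} {s : ℤ} (hax : a • x = 0)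
    (ha : ∀ j, s < j → (decompose 𝒜 a j : R) = 0) :
    ∃ n, (decompose 𝒜 a s : R) ^ n • x = 0 := by
  obtain ⟨b, k, hx⟩ := exists_forall_notMem_of_finite (G.finite x)
  replace hx : ∀ i, i < b ∨ b + k < i → G.proj i x = 0 := fun i hi => not_not.mp (hx i hi)
  refine ⟨k + 1, G.smul_eq_zero_of_forall_proj fun i => ?_⟩
  by_cases hi : i < b ∨ b + k < i
  · rw [hx i hi, smul_zero]
  obtain ⟨m, hm, hmk⟩ : ∃ m : ℕ, i = b + k - m ∧ m ≤ k := ⟨(b + k - i).toNat, by omega, by omega⟩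
  rw [hm, ← Nat.sub_add_cancel (Nat.add_le_add_right hmk 1), pow_add, mul_smul,
    G.leading_pow_smul_proj_eq_zero hax ha (fun j hj => hx j (Or.inr hj)), smul_zero]

variable [IsNoetherianRing R]

include G in
theorem isHomogeneous_of_mem_associatedPrimes {p : Ideal R} (hp : p ∈ associatedPrimes R M) :
    p.IsHomogeneous 𝒜 := by
  obtain ⟨hprime, x, hx⟩ := mem_associatedPrimes_iff.mp hp
  refine isHomogeneous_of_forall_leading_mem fun a hap s ha => ?_
  obtain ⟨n, hn⟩ := G.exists_leading_pow_smul_eq_zero ((hx a).mp hap) ha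
  exact hprime.mem_of_pow_mem n ((hx _).mpr hn)

include G in
theorem isHomogeneous_radical_annihilator [Module.Finite R M] {N : Submodule R M} :
    (Module.annihilator R N).radical.IsHomogeneous 𝒜 := by
  rw [← Ideal.sInf_minimalPrimes]
  refine Ideal.IsHomogeneous.sInf fun I hI => G.isHomogeneous_of_mem_associatedPrimes ?_
  exact associatedPrimes.subset_of_injective N.subtype_injective
    (Module.associatedPrimes.minimalPrimes_annihilator_subset_associatedPrimes R N hI)

theorem proj_mem_dimSub [Module.Finite R M] (n : ℕ) (i : ℤ) (x : M) (hx : x ∈ dimSub R M n) :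
    G.proj i x ∈ dimSub R M n := by
  intro p hp
  have hnle : ¬ (Module.annihilator R (dimSub R M n)).radical ≤ p.asIdeal := fun hle => by
    have hsupp : p ∈ Module.support R (dimSub R M n) := by
      rw [Module.support_eq_zeroLocus]
      exact Ideal.le_radical.trans hle
    exact (supportDim_lt_iff.mp (supportDim_dimSub_lt (M := M) n) p hsupp).not_ge hp
  obtain ⟨d, r, hrd, ⟨k, hk⟩, hrp⟩ :=
    exists_homogeneous_notMem_of_not_le G.isHomogeneous_radical_annihilator hnle
  refine ⟨r ^ k, fun h => hrp (p.2.mem_of_pow_mem k h), ?_⟩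
  have hrx : r ^ k • x = 0 := congrArg Subtype.val (Module.mem_annihilator.mp hk ⟨x, hx⟩)
  rw [← G.proj_smul (SetLike.pow_mem_graded k hrd), hrx, map_zero]

/-- The grading induced on the quotients of the filtration by dimension. -/
def dimQuot [Module.Finite R M] (n : ℕ) : ModuleGrading 𝒜 (DimQuot R M n) :=
  (G.restrict (dimSub R M (n + 1)) (G.proj_mem_dimSub (n + 1))).quotient _
    fun i x hx => G.proj_mem_dimSub n i x hx

variable {q : PrimeSpectrum R}

include G

theorem le_homCore_of_mem_associatedPrimes {p : PrimeSpectrum R}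
    (hp : p.asIdeal ∈ associatedPrimes R M) (hpq : p ≤ q) : p ≤ homCore 𝒜 q :=
  le_homCore (G.isHomogeneous_of_mem_associatedPrimes hp) hpq

variable [Module.Finite R M]

theorem homCore_mem_support (hq : q ∈ Module.support R M) : homCore 𝒜 q ∈ Module.support R M := by
  obtain ⟨p, hp, hle⟩ := exists_associatedPrime_le_of_mem_support hq
  exact Module.mem_support_mono (G.le_homCore_of_mem_associatedPrimes hp hle)
    (mem_support_of_mem_associatedPrimes hp)

theorem exists_homogeneous_isRegularAt (hq : homCore 𝒜 q ≠ q)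
    (hass : (homCore 𝒜 q).asIdeal ∉ associatedPrimes R M) :
    ∃ d, ∃ x ∈ 𝒜 d, x ∈ (homCore 𝒜 q).asIdeal ∧ IsRegularAt M q x := by
  obtain ⟨e, he, t, ht, htq⟩ := exists_degree_ne_zero_notMem_homCore hq
  let T : Set (Ideal R) := {p ∈ associatedPrimes R M | p ≤ (homCore 𝒜 q).asIdeal}
  have hT : ∀ p ∈ T, p.IsPrime ∧ p.IsHomogeneous 𝒜 ∧ p < (homCore 𝒜 q).asIdeal := fun p hp =>
    ⟨hp.1.isPrime, G.isHomogeneous_of_mem_associatedPrimes hp.1,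
      lt_of_le_of_ne hp.2 fun h => hass (h ▸ hp.1)⟩
  obtain ⟨d, x, hxd, hxq, hx⟩ := exists_homogeneous_forall_notMem (homCore_isHomogeneous 𝒜 q) he ht
    htq ((associatedPrimes.finite R M).subset fun _ h => h.1) hT
  exact ⟨d, x, hxd, hxq, fun p hp hle => hx _ ⟨hp, G.le_homCore_of_mem_associatedPrimes hp hle⟩⟩

theorem hasDepthAt_succ_of_homCore (hq : homCore 𝒜 q ≠ q) {n : ℕ}
    (h : HasDepthAt (homCore 𝒜 q) n M) : HasDepthAt q (n + 1) M := by
  induction n generalizing M with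
  | zero =>
    obtain ⟨x, hxq, hx⟩ := exists_mem_isRegularAt (M := M) (q := q) fun hass =>
      hq (homCore_eq_of_isHomogeneous (G.isHomogeneous_of_mem_associatedPrimes hass))
    refine ⟨x, hxq, hx, ?_⟩
    rw [HasDepthAt, Module.support_quotSMulTop]
    exact ⟨Module.mem_support_mono (homCore_le 𝒜 q) h, by simpa using hxq⟩
  | succ n ih =>
    have hass : (homCore 𝒜 q).asIdeal ∉ associatedPrimes R M := fun hass => by
      have := h.le_relHeight hass le_rfl
      rw [relHeight_self] at this
      norm_cast at this
    obtain ⟨d, x, hxd, hxq, hx⟩ := G.exists_homogeneous_isRegularAt hq hass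
    exact ⟨x, homCore_le 𝒜 q hxq, hx,
      ih (G.quotSMulTop hxd) (h.quotSMulTop hxq (hx.of_le (homCore_le 𝒜 q)))⟩

theorem isCMAt_succ_of_homCore (hq : homCore 𝒜 q ≠ q) {n : ℕ}
    (h : IsCMAt M (homCore 𝒜 q) n) : IsCMAt M q (n + 1) := by
  refine ⟨G.hasDepthAt_succ_of_homCore hq h.1, fun p hp hpq => ?_⟩
  obtain ⟨p₀, hp₀, hle⟩ := exists_associatedPrime_le_of_mem_support hp
  calc relHeight p q ≤ relHeight p₀ q := relHeight_mono hle le_rfl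
    _ ≤ relHeight p₀ (homCore 𝒜 q) + 1 :=
      relHeight_le_relHeight_homCore_add_one (G.isHomogeneous_of_mem_associatedPrimes hp₀)
    _ ≤ ((n + 1 : ℕ) : ℕ∞) := by
      push_cast
      gcongr
      exact h.2 p₀ (mem_support_of_mem_associatedPrimes hp₀)
        (G.le_homCore_of_mem_associatedPrimes hp₀ (hle.trans hpq))

end ModuleGrading

end GradedModules

/-! ### H-local rings -/

section HLocalRing

variable {R : Type*} [CommRing R] (𝒜 : ℤ → AddSubgroup R) [GradedRing 𝒜] [IsHLocalRing 𝒜]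

/-- The H-maximal ideal as a point of the prime spectrum. -/
noncomputable def hClosedPoint : PrimeSpectrum R := ⟨hMaximalIdeal 𝒜, inferInstance⟩

/-- The dimension of `R ⧸ P` for the H-maximal ideal `P`: it is `0` if `P` is a maximal ideal and
`1` otherwise. -/
noncomputable def hDefect : ℕ := open Classical in if (hMaximalIdeal 𝒜).IsMaximal then 0 else 1

variable {𝒜}

theorem isMax_hClosedPoint_iff : IsMax (hClosedPoint 𝒜) ↔ (hMaximalIdeal 𝒜).IsMaximal :=
  PrimeSpectrum.isMax_iff

variable [IsNoetherianRing R]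

theorem le_hMaximalIdeal {I : Ideal R} (hI : I.IsHomogeneous 𝒜) (hne : I ≠ ⊤) :
    I ≤ hMaximalIdeal 𝒜 := by
  obtain ⟨J, ⟨hJ, hIJ, hJne⟩, hmax⟩ := WellFounded.has_min
    (wellFounded_gt (α := Ideal R)) {J | J.IsHomogeneous 𝒜 ∧ I ≤ J ∧ J ≠ ⊤} ⟨I, hI, le_rfl, hne⟩
  have hJmax : IsHMaximal 𝒜 J := ⟨hJ, hJne, fun K hK hlt => by
    by_contra hKne
    exact hmax K ⟨hK, hIJ.trans hlt.le, hKne⟩ hlt⟩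
  rwa [← (IsHLocalRing.existsUnique_isHMaximal (𝒜 := 𝒜)).unique hJmax
    (hMaximalIdeal_isHMaximal 𝒜)]

theorem le_hClosedPoint {p : PrimeSpectrum R} (hp : p.asIdeal.IsHomogeneous 𝒜) :
    p ≤ hClosedPoint 𝒜 :=
  le_hMaximalIdeal hp p.2.ne_top

theorem homCore_le_hClosedPoint (q : PrimeSpectrum R) : homCore 𝒜 q ≤ hClosedPoint 𝒜 :=
  le_hClosedPoint (homCore_isHomogeneous 𝒜 q)

theorem one_le_relHeight_homCore_add_hDefect {q : PrimeSpectrum R} (hq : homCore 𝒜 q ≠ q) :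
    1 ≤ relHeight (homCore 𝒜 q) (hClosedPoint 𝒜) + hDefect 𝒜 := by
  rcases (homCore_le_hClosedPoint (𝒜 := 𝒜) q).lt_or_eq with hlt | heq
  · refine le_trans ?_ le_self_add
    simpa only [relHeight_self, zero_add] using relHeight_add_one_le_of_lt_left hlt le_rfl
  · have hlt : hClosedPoint 𝒜 < q := heq ▸ lt_of_le_of_ne (homCore_le 𝒜 q) hq
    have hnot : ¬ (hMaximalIdeal 𝒜).IsMaximal := fun h =>
      (isMax_hClosedPoint_iff.mpr h).not_lt hlt
    rw [hDefect, if_neg hnot, Nat.cast_one]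
    exact le_add_self

theorem coheight_eq_relHeight_hClosedPoint_add {p : PrimeSpectrum R}
    (hp : p.asIdeal.IsHomogeneous 𝒜) :
    Order.coheight p = relHeight p (hClosedPoint 𝒜) + hDefect 𝒜 := by
  apply le_antisymm
  · rw [coheight_eq_iSup_relHeight]
    refine iSup_le fun ⟨m, hpm⟩ => ?_
    by_cases hm : homCore 𝒜 m = m
    · exact (relHeight_mono le_rfl (hm.symm.le.trans (homCore_le_hClosedPoint m))).trans le_self_add
    · calc relHeight p m ≤ relHeight p (homCore 𝒜 m) + 1 :=
          relHeight_le_relHeight_homCore_add_one hp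
        _ ≤ relHeight p (homCore 𝒜 m) +
            (relHeight (homCore 𝒜 m) (hClosedPoint 𝒜) + hDefect 𝒜) := by
          gcongr
          exact one_le_relHeight_homCore_add_hDefect hm
        _ ≤ relHeight p (hClosedPoint 𝒜) + hDefect 𝒜 := by
          rw [← add_assoc]
          gcongr
          exact relHeight_add_le (le_homCore hp hpm) (homCore_le_hClosedPoint m)
  · refine le_trans ?_ (relHeight_add_coheight_le (le_hClosedPoint hp))
    gcongr
    by_cases h : (hMaximalIdeal 𝒜).IsMaximal
    · simp [hDefect, h]
    · rw [hDefect, if_neg h, Nat.cast_one, Order.one_le_iff_ne_zero, Order.coheight_ne_zero,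
        isMax_hClosedPoint_iff]
      exact h

theorem exists_relHeight_add_eq_relHeight_homCore_add (q : PrimeSpectrum R) :
    ∃ c : ℕ, ∀ p : PrimeSpectrum R, p.asIdeal.IsHomogeneous 𝒜 → p ≤ q → relHeight p q + c =
      relHeight p (homCore 𝒜 q) + (relHeight (homCore 𝒜 q) (hClosedPoint 𝒜) + hDefect 𝒜) := by
  obtain ⟨a, ha⟩ := ENat.ne_top_iff_exists.mp (relHeight_ne_top (homCore 𝒜 q) (hClosedPoint 𝒜))
  rw [← ha]
  by_cases hq : homCore 𝒜 q = q
  · exact ⟨a + hDefect 𝒜, fun p _ _ => by rw [hq, Nat.cast_add]⟩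
  · have hpos := one_le_relHeight_homCore_add_hDefect hq
    rw [← ha] at hpos
    obtain ⟨c, hc⟩ := Nat.exists_eq_add_of_le (m := 1) (n := a + hDefect 𝒜) (mod_cast hpos)
    refine ⟨c, fun p hp hpq => ?_⟩
    rw [relHeight_eq_relHeight_homCore_add_one hp hpq hq, ← Nat.cast_add, hc, Nat.cast_add,
      Nat.cast_one, add_assoc]

namespace ModuleGrading

variable {M : Type*} [AddCommGroup M] [Module R M] [Module.Finite R M] (G : ModuleGrading 𝒜 M)

include G

theorem isCohenMacaulayModule_iff : IsCohenMacaulayModule R M ↔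
    (hClosedPoint 𝒜 ∈ Module.support R M → ∃ n, IsCMAt M (hClosedPoint 𝒜) n) := by
  refine ⟨fun h hP => h.exists_isCMAt hP, fun h => ?_⟩
  rw [_root_.isCohenMacaulayModule_iff]
  intro m hm _
  have hle := homCore_le_hClosedPoint (𝒜 := 𝒜) m
  have hm' := G.homCore_mem_support hm
  obtain ⟨n, hn⟩ := h (Module.mem_support_mono hle hm')
  obtain ⟨k, hk, -⟩ := hn.exists_of_le hle hm'
  by_cases hmh : homCore 𝒜 m = m
  · exact ⟨k, hmh ▸ hk⟩
  · exact ⟨k + 1, G.isCMAt_succ_of_homCore hmh hk⟩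

theorem exists_supportDim_lt : ∃ N : ℕ, Module.supportDim R M < N := by
  obtain ⟨H, hH⟩ := ENat.ne_top_iff_exists.mp
    (Ideal.height_ne_top (I := (hClosedPoint 𝒜).asIdeal) (hClosedPoint 𝒜).2.ne_top)
  rw [PrimeSpectrum.height_eq_orderHeight] at hH
  refine ⟨H + hDefect 𝒜 + 1, supportDim_lt_iff_associatedPrimes.mpr fun p hp => ?_⟩
  rw [coheight_eq_relHeight_hClosedPoint_add (G.isHomogeneous_of_mem_associatedPrimes hp)]
  calc relHeight p (hClosedPoint 𝒜) + hDefect 𝒜 ≤ (H + hDefect 𝒜 : ℕ) := by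
        push_cast
        gcongr
        exact (relHeight_le_height _ _).trans_eq hH.symm
    _ < (H + hDefect 𝒜 + 1 : ℕ) := by exact_mod_cast Nat.lt_succ_self _

variable {n : ℕ} {p : PrimeSpectrum R}

theorem relHeight_hClosedPoint_add_eq_of_mem_associatedPrimes_dimQuot
    (hp : p.asIdeal ∈ associatedPrimes R (DimQuot R M n)) :
    relHeight p (hClosedPoint 𝒜) + hDefect 𝒜 = n := by
  rw [← coheight_eq_relHeight_hClosedPoint_add
    ((G.dimQuot n).isHomogeneous_of_mem_associatedPrimes hp)]
  exact coheight_eq_of_mem_associatedPrimes_dimQuot hp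

/-- Cohen-Macaulayness enters through the additivity of relative heights along
`p ≤ homCore 𝒜 q ≤ hClosedPoint 𝒜`. -/
theorem relHeight_homCore_add_eq_of_mem_associatedPrimes_dimQuot
    (hCM : IsCohenMacaulayModule R (DimQuot R M n))
    (hp : p.asIdeal ∈ associatedPrimes R (DimQuot R M n)) {q : PrimeSpectrum R} (hpq : p ≤ q) :
    relHeight p (homCore 𝒜 q) + (relHeight (homCore 𝒜 q) (hClosedPoint 𝒜) + hDefect 𝒜) = n := by
  have hpq' : p ≤ homCore 𝒜 q := (G.dimQuot n).le_homCore_of_mem_associatedPrimes hp hpq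
  have hqP := homCore_le_hClosedPoint (𝒜 := 𝒜) q
  have hsupp := mem_support_of_mem_associatedPrimes hp
  obtain ⟨d, hd⟩ := hCM.exists_isCMAt (Module.mem_support_mono (hpq'.trans hqP) hsupp)
  obtain ⟨k, hk, hkd⟩ := hd.exists_of_le hqP (Module.mem_support_mono hpq' hsupp)
  rw [← add_assoc, hk.relHeight_eq hp hpq', hkd, ← hd.relHeight_eq hp (hpq'.trans hqP)]
  exact G.relHeight_hClosedPoint_add_eq_of_mem_associatedPrimes_dimQuot hp

theorem exists_relHeight_add_eq (hCM : ∀ k, IsCohenMacaulayModule R (DimQuot R M k))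
    (q : PrimeSpectrum R) :
    ∃ c : ℕ, ∀ k, ∀ p : PrimeSpectrum R, p.asIdeal ∈ associatedPrimes R (DimQuot R M k) → p ≤ q →
      relHeight p q + c = k := by
  obtain ⟨c, hc⟩ := exists_relHeight_add_eq_relHeight_homCore_add (𝒜 := 𝒜) q
  refine ⟨c, fun k p hp hpq => ?_⟩
  rw [hc p ((G.dimQuot k).isHomogeneous_of_mem_associatedPrimes hp) hpq]
  exact G.relHeight_homCore_add_eq_of_mem_associatedPrimes_dimQuot (hCM k) hp hpq

end ModuleGrading

end HLocalRing

theorem theorem2p4 {R : Type*} [CommRing R] [IsNoetherianRing R]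
    (𝒜 : ℤ → AddSubgroup R) [GradedRing 𝒜] [IsHLocalRing 𝒜]
    {M : Type*} [AddCommGroup M] [Module R M] [Module.Finite R M] [Nontrivial M]
    (ℳ : ℤ → AddSubgroup M) [DirectSum.Decomposition ℳ] [SetLike.GradedSMul 𝒜 ℳ] :
    (IsSequentiallyCM R M ↔
      IsSequentiallyCM (Localization.AtPrime (hMaximalIdeal 𝒜))
        (LocalizedModule (hMaximalIdeal 𝒜).primeCompl M)) ∧
    (IsSequentiallyCM R M → ∀ p ∈ Module.support R M,
      IsSequentiallyCM (Localization.AtPrime p.asIdeal)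
        (LocalizedModule p.asIdeal.primeCompl M)) := by
  let G : ModuleGrading 𝒜 M := .ofDecomposition ℳ
  obtain ⟨N, hN⟩ := G.exists_supportDim_lt
  rw [isSequentiallyCM_iff hN]
  constructor
  · have hP := isSequentiallyCM_atPrime_iff (hClosedPoint 𝒜)
      (A := Localization.AtPrime (hClosedPoint 𝒜).asIdeal)
      (LocalizedModule.mkLinearMap (hClosedPoint 𝒜).asIdeal.primeCompl M)
      (fun _ _ hp _ => G.relHeight_hClosedPoint_add_eq_of_mem_associatedPrimes_dimQuot hp) hN
    exact (forall_congr' fun k => (G.dimQuot k).isCohenMacaulayModule_iff).trans hP.symm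
  · intro h q _
    obtain ⟨c, hc⟩ := G.exists_relHeight_add_eq h q
    rw [isSequentiallyCM_atPrime_iff q (LocalizedModule.mkLinearMap q.asIdeal.primeCompl M) hc hN]
    exact fun k hk => (h k).exists_isCMAt hk
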